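/- Let $d\ge 2$ be an integer and $0<p\le 1$. The random $d$-uniform preferential attachment hypergraph $H_t=H_t(H_0,p,d)$, $t=0,1,2,\dots$, evolves as follows. Hyperedges are multisets of $d$ vertices, distinct hyperedges may have the same members, and the degree of a vertex is the number of hyperedges that contain it (a hyperedge counts once, even if it contains the vertex several times). $H_0$ has a single vertex and a single hyperedge, which consists of $d$ copies of this vertex. At time $t\ge 1$, with probability $p$ a new vertex $u$ is added together with a hyperedge formed by $u$ and $d-1$ vertices of $H_{t-1}$, and with probability $1-p$ only a hyperedge formed by $d$ vertices of $H_{t-1}$ is added; in both cases the vertices of $H_{t-1}$ are chosen independently, with repetitions allowed, each with probability proportional to its degree in $H_{t-1}$. The observed graph $G(H_t)$ is the simple graph on the vertices of $H_t$ in which two distinct vertices are adjacent if and only if some hyperedge of $H_t$ contains both. Then the degree distribution of the observed graph follows a power law with exponent $\beta=2+\frac{p}{d-p}$. Precisely, let $m_{k,t}$ be the number of vertices of degree $k$ in $G(H_t)$. For every $k\ge 0$ the limit $M_k=\lim_{t\to\infty}\mathbb E[m_{k,t}]/t$ exists, $\sum_k M_k=p$, $M_k=0$ unless $d-1$ divides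 $k$, and there are constants $c,C>0$ (depending only on $d$ and $p$) such that $$M_k\sim c\,k^{-\beta}\quad\text{as } k\to\infty \text{ through the multiples of } d-1,\qquad \sum_{j\ge k}M_j\sim C\,k^{-(\beta-1)}\quad\text{as } k\to\infty.$$ For $d>2$ this exponent differs from the exponent $2+\frac{p}{2-p}$ of an ordinary preferential attachment graph, that is, of the $2$-uniform hypergraph $H_t(H_0,p,2)$: if $m'_{k,t}$ is the number of vertices of degree $k$ in $H_t(H_0,p,2)$, then the limits $M'_k=\lim_{t\to\infty}\mathbb E[m'_{k,t}]/t$ exist, $\sum_k M'_k=p$, and with $\beta'=2+\frac{p}{2-p}$ there are constants $c',C'>0$ such that $M'_k\sim c'\,k^{-\beta'}$ and $\sum_{j\ge k}M'_j\sim C'\,k^{-(\beta'-1)}$ as $k\to\infty$. -/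

import Mathlib

open MeasureTheory Filter Topology
open scoped NNReal ENNReal

namespace PrefAttach

/-- A finite hypergraph on the vertices `0, …, n - 1`. Hyperedges are multisets of vertices (a vertex
may be repeated in a hyperedge, which is a self loop) and the hyperedges form a multiset as well
(two hyperedges may have the same members). Some hyperedge has a member, so that choosing a vertex
proportionally to the degrees makes sense. -/
structure MultiHypergraph where
  n : ℕ
  edges : Multiset (Multiset ℕ)
  incidence : ∀ e ∈ edges, ∀ v ∈ e, v < n
  exists_mem : ∃ e ∈ edges, ∃ v, v ∈ e

namespace MultiHypergraph

instance : MeasurableSpace MultiHypergraph := ⊤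

/-- The degree of a vertex: the number of hyperedges that contain it. A hyperedge counts once, even
if it contains the vertex several times. -/
def degree (H : MultiHypergraph) (v : ℕ) : ℕ :=
  H.edges.countP (v ∈ ·)

theorem tsum_degree_ne_zero (H : MultiHypergraph) :
    ∑' v : Fin H.n, (H.degree v : ℝ≥0∞) ≠ 0 := by
  obtain ⟨e, he, v, hv⟩ := H.exists_mem
  intro h
  have h1 := ENNReal.tsum_eq_zero.1 h ⟨v, H.incidence e he v hv⟩
  have h2 : 0 < H.degree v := Multiset.countP_pos.2 ⟨e, he, hv⟩
  simp only [Nat.cast_eq_zero] at h1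
  omega

theorem tsum_degree_ne_top (H : MultiHypergraph) :
    ∑' v : Fin H.n, (H.degree v : ℝ≥0∞) ≠ ∞ := by
  rw [tsum_fintype]
  exact ENNReal.sum_ne_top.2 fun v _ => ENNReal.natCast_ne_top _

/-- A random vertex of `H`, chosen proportionally to the degrees in `H`. -/
noncomputable def preferentialVertex (H : MultiHypergraph) : PMF (Fin H.n) :=
  PMF.normalize (fun v => (H.degree v : ℝ≥0∞)) H.tsum_degree_ne_zero H.tsum_degree_ne_top

/-- Add a hyperedge with the given members. -/
def addEdge (H : MultiHypergraph) (s : Multiset (Fin H.n)) : MultiHypergraph where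
  n := H.n
  edges := s.map Fin.val ::ₘ H.edges
  incidence := by
    intro e he v hv
    rcases Multiset.mem_cons.1 he with rfl | he
    · obtain ⟨w, -, rfl⟩ := Multiset.mem_map.1 hv
      exact w.isLt
    · exact H.incidence e he v hv
  exists_mem := by
    obtain ⟨e, he, h⟩ := H.exists_mem
    exact ⟨e, Multiset.mem_cons_of_mem he, h⟩

/-- Add a new vertex, together with a hyperedge formed by it and the given old vertices. -/
def addVertexEdge (H : MultiHypergraph) (s : Multiset (Fin H.n)) : MultiHypergraph where
  n := H.n + 1
  edges := (H.n ::ₘ s.map Fin.val) ::ₘ H.edges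
  incidence := by
    intro e he v hv
    rcases Multiset.mem_cons.1 he with rfl | he
    · rcases Multiset.mem_cons.1 hv with rfl | hv
      · exact Nat.lt_succ_self _
      · obtain ⟨w, -, rfl⟩ := Multiset.mem_map.1 hv
        exact w.isLt.trans (Nat.lt_succ_self _)
    · exact (H.incidence e he v hv).trans (Nat.lt_succ_self _)
  exists_mem := by
    obtain ⟨e, he, h⟩ := H.exists_mem
    exact ⟨e, Multiset.mem_cons_of_mem he, h⟩

/-- The observed graph of `H`: same vertices, and every hyperedge becomes a clique. -/
def observedGraph (H : MultiHypergraph) : SimpleGraph (Fin H.n) where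
  Adj u v := u ≠ v ∧ ∃ e ∈ H.edges, (u : ℕ) ∈ e ∧ (v : ℕ) ∈ e
  symm := ⟨fun _ _ h => ⟨h.1.symm, h.2.imp fun _ he => ⟨he.1, he.2.2, he.2.1⟩⟩⟩
  loopless := ⟨fun _ h => h.1 rfl⟩

/-- The number of vertices of degree `k` in the hypergraph. -/
def numDegree (H : MultiHypergraph) (k : ℕ) : ℕ :=
  (Finset.univ.filter fun v : Fin H.n => H.degree v = k).card

open Classical in
/-- The number of vertices of degree `k` in the observed graph. -/
noncomputable def numObservedDegree (H : MultiHypergraph) (k : ℕ) : ℕ :=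
  (Finset.univ.filter fun v : Fin H.n => H.observedGraph.degree v = k).card

end MultiHypergraph

/-- The multiset of the outcomes of `k` independent draws from `q`. -/
noncomputable def draws {α : Type*} (q : PMF α) : ℕ → PMF (Multiset α)
  | 0 => PMF.pure 0
  | k + 1 => q.bind fun a => (draws q k).map fun s => a ::ₘ s

/-- A biased bit, `true` with probability `p`. -/
noncomputable def coin (p : ℝ≥0) (hp : p ≤ 1) : PMF Bool :=
  PMF.ofFintype (fun b => if b then (p : ℝ≥0∞) else 1 - (p : ℝ≥0∞)) (by
    have h : (p : ℝ≥0∞) ≤ 1 := by exact_mod_cast hp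
    simpa using add_tsub_cancel_of_le h)

/-- One time step of the `d`-uniform evolution. -/
noncomputable def step (d : ℕ) (p : ℝ≥0) (hp : p ≤ 1) (H : MultiHypergraph) :
    PMF MultiHypergraph :=
  (coin p hp).bind fun b =>
    if b then (draws H.preferentialVertex (d - 1)).map H.addVertexEdge
    else (draws H.preferentialVertex d).map H.addEdge

/-- The initial hypergraph: a single hyperedge of cardinality `d` over a single vertex. -/
def initial (d : ℕ) (hd : 2 ≤ d) : MultiHypergraph where
  n := 1
  edges := {Multiset.replicate d 0}
  incidence := by
    intro e he v hv
    rw [Multiset.mem_singleton.1 he] at hv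
    rw [Multiset.eq_of_mem_replicate hv]
    exact Nat.one_pos
  exists_mem :=
    ⟨_, Multiset.mem_singleton_self _, 0, Multiset.mem_replicate.2 ⟨by omega, rfl⟩⟩

/-- The law of the random `d`-uniform preferential attachment hypergraph at time `t`. -/
noncomputable def law (d : ℕ) (hd : 2 ≤ d) (p : ℝ≥0) (hp : p ≤ 1) : ℕ → PMF MultiHypergraph
  | 0 => PMF.pure (initial d hd)
  | t + 1 => (law d hd p hp t).bind (step d p hp)

/-- The expected number of vertices of degree `k` in the random hypergraph at time `t`. -/
noncomputable def expectedNum (d : ℕ) (hd : 2 ≤ d) (p : ℝ≥0) (hp : p ≤ 1) (k t : ℕ) : ℝ :=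
  ∫ H, (H.numDegree k : ℝ) ∂(law d hd p hp t).toMeasure

/-- The expected number of vertices of degree `k` in the observed graph at time `t`. -/
noncomputable def expectedNumObserved (d : ℕ) (hd : 2 ≤ d) (p : ℝ≥0) (hp : p ≤ 1) (k t : ℕ) : ℝ :=
  ∫ H, (H.numObservedDegree k : ℝ) ∂(law d hd p hp t).toMeasure

/-- The sequence `M` of (not normalized) degree frequencies lives on the multiples of `s` and follows
a power law with exponent `β`: `M k ∼ c k ^ (-β)` as `k → ∞` through the multiples of `s`, and
`∑ j ≥ k, M j ∼ C k ^ (-(β - 1))` as `k → ∞` through all integers. -/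
def IsPowerLaw (s : ℕ) (M : ℕ → ℝ) (β : ℝ) : Prop :=
  Summable M ∧ (∀ k, ¬ s ∣ k → M k = 0) ∧
    (∃ c : ℝ, 0 < c ∧
      Tendsto (fun k : ℕ => M (s * k) * ((s * k : ℕ) : ℝ) ^ β) atTop (𝓝 c)) ∧
    ∃ C : ℝ, 0 < C ∧
      Tendsto (fun k : ℕ => (∑' j, M (k + j)) * (k : ℝ) ^ (β - 1)) atTop (𝓝 C)

end PrefAttach

/-! Let S be the total degree and w(v) = deg(v)/S. A vertex of degree k joins the next hyperedge
with probability p(1-(1-w)^(d-1)) + (1-p)(1-(1-w)^d), which is (d-p)k/S to first order. If S were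
d(t+1), then with α = (d-p)/d the expected degree counts would satisfy E m_k(t+1) = (1 - αk/(t+1)) E
m_k(t) + α(k-1)/(t+1) E m_{k-1}(t) + p[k=1]. Dividing by t+1 gives limits with (1+αk)M_k =
α(k-1)M_{k-1} + p[k=1], which is `freq`. This recursion has a Gamma-quotient solution of order
k^-(1+1/α), and 1 + 1/α = 2 + p/(d-p). Its tails telescope exactly, which gives both the total mass
p and the tail asymptotics.

The difficulty is that S is random: a vertex repeated in a hyperedge gains only one degree. The loss
is controlled by the collision probability Y = ∑ w². Repetitions cost at most d²Y in expectation per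
step, so E Y → 0 yields S = d(t+1) - o(t) in mean. That E Y → 0 comes from a drift inequality
(`stepE_collision_le`): the chance that a vertex is hit is concave in its weight, so by Chebyshev's
sum inequality (`sum_mul_hit_le`) the old vertices do not raise Y to first order, while each new
vertex dilutes it at rate 2p/S. The error is of order 1/S², and the divergence of the harmonic
series finishes the argument.

In the observed graph a vertex has at most (d-1)deg(v) neighbours, with equality unless one of its
hyperedges repeats a member or meets an earlier neighbour. For vertices with at most j neighbours
both events become rare as E Y → 0 (`stepE_defectCount_le`), so only o(t) such vertices are affected
in mean. The observed frequencies are therefore `freq` moved to the multiples of d-1. -/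

namespace PrefAttach

/-! ### Limits from recursive inequalities with step size 1/t -/

/-- Since 1 - x ≤ exp(-x), the product of the factors is at most exp(-b · harmonic sum), which tends
to 0. -/
theorem tendsto_zero_of_contraction {w : ℕ → ℝ} {b : ℝ} (hb : 0 < b) (hw : ∀ t, 0 ≤ w t)
    (h : ∀ᶠ t : ℕ in atTop, w (t + 1) ≤ (1 - b / ((t : ℝ) + 2)) * w t) :
    Tendsto w atTop (𝓝 0) := by
  obtain ⟨T, hT⟩ := eventually_atTop.1 h
  have key : ∀ m : ℕ, w (T + m) ≤
      w T * Real.exp (-(b * ∑ i ∈ Finset.range m, 1 / (((T + i : ℕ) : ℝ) + 2))) := by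
    intro m
    induction m with
    | zero => simp
    | succ m ih =>
      have h1 := hT (T + m) (by omega)
      have h2 : 1 - b / (((T + m : ℕ) : ℝ) + 2) ≤ Real.exp (-(b / (((T + m : ℕ) : ℝ) + 2))) := by
        have := Real.add_one_le_exp (-(b / (((T + m : ℕ) : ℝ) + 2)))
        linarith
      calc w (T + (m + 1)) ≤ (1 - b / (((T + m : ℕ) : ℝ) + 2)) * w (T + m) := h1
        _ ≤ Real.exp (-(b / (((T + m : ℕ) : ℝ) + 2))) * w (T + m) := by
            gcongr; exact hw _
        _ ≤ Real.exp (-(b / (((T + m : ℕ) : ℝ) + 2))) * (w T *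
            Real.exp (-(b * ∑ i ∈ Finset.range m, 1 / (((T + i : ℕ) : ℝ) + 2)))) := by gcongr
        _ = _ := by
            rw [Finset.sum_range_succ, mul_left_comm, ← Real.exp_add]
            congr 2
            ring
  have hdiv : Tendsto (fun m => ∑ i ∈ Finset.range m, 1 / (((T + i : ℕ) : ℝ) + 2)) atTop atTop := by
    have h1 := Real.tendsto_sum_range_one_div_nat_succ_atTop
    have h2 : Tendsto (fun m => ∑ i ∈ Finset.range (T + 1 + m), (1 / ((i : ℝ) + 1))) atTop atTop :=
      h1.comp (tendsto_add_atTop_nat (T + 1) |>.congr fun m => by simp [add_comm])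
    have h3 := tendsto_atTop_add_const_left atTop
      (-∑ i ∈ Finset.range (T + 1), (1 / ((i : ℝ) + 1))) h2
    refine h3.congr fun m => ?_
    rw [Finset.sum_range_add _ (T + 1) m, neg_add_cancel_left]
    refine Finset.sum_congr rfl fun i _ => ?_
    push_cast
    congr 1
    ring
  have hlim : Tendsto (fun m => w T *
      Real.exp (-(b * ∑ i ∈ Finset.range m, 1 / (((T + i : ℕ) : ℝ) + 2)))) atTop (𝓝 0) := by
    have := (Real.tendsto_exp_neg_atTop_nhds_zero.comp (hdiv.const_mul_atTop hb)).const_mul (w T)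
    simpa using this
  rw [← tendsto_add_atTop_iff_nat T]
  refine squeeze_zero (fun m => hw _) (fun m => ?_) hlim
  rw [add_comm]
  exact key m

theorem eventually_div_le_one (b : ℝ) : ∀ᶠ t : ℕ in atTop, b / ((t : ℝ) + 2) ≤ 1 := by
  filter_upwards [tendsto_natCast_atTop_atTop.eventually_ge_atTop b] with t ht
  have : (0 : ℝ) ≤ t := t.cast_nonneg
  rw [div_le_one (by linarith)]
  linarith

/-- Once ε t ≤ bδ, the perturbation is absorbed by the level δ, so the excess of z over δ obeys the
pure contraction. -/
theorem tendsto_zero_of_recursive_le {z ε : ℕ → ℝ} {b : ℝ} (hb : 0 < b) (hz : ∀ t, 0 ≤ z t)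
    (h : ∀ᶠ t : ℕ in atTop, z (t + 1) ≤ (1 - b / ((t : ℝ) + 2)) * z t + ε t / ((t : ℝ) + 2))
    (hε : Tendsto ε atTop (𝓝 0)) : Tendsto z atTop (𝓝 0) := by
  have main : ∀ δ : ℝ, 0 < δ → Tendsto (fun t => max (z t - δ) 0) atTop (𝓝 0) := by
    intro δ hδ
    refine tendsto_zero_of_contraction hb (fun t => le_max_right _ _) ?_
    filter_upwards [h, hε.eventually_le_const (mul_pos hb hδ), eventually_div_le_one b]
      with t ht h1 h2
    have h3 : (0 : ℝ) < (t : ℝ) + 2 := by positivity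
    have h4 : 0 ≤ 1 - b / ((t : ℝ) + 2) := by linarith
    refine max_le ?_ (mul_nonneg h4 (le_max_right _ _))
    have h5 : ε t / ((t : ℝ) + 2) ≤ b * δ / ((t : ℝ) + 2) := by gcongr
    have h6 := mul_le_mul_of_nonneg_left (le_max_left (z t - δ) 0) h4
    have h7 : b * δ / ((t : ℝ) + 2) = b / ((t : ℝ) + 2) * δ := by ring
    nlinarith
  rw [Metric.tendsto_atTop]
  intro δ hδ
  obtain ⟨T, hT⟩ := eventually_atTop.1 ((main (δ / 2) (by linarith)).eventually_lt_const
    (show (0 : ℝ) < δ / 2 by linarith))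
  refine ⟨T, fun t ht => ?_⟩
  rw [Real.dist_eq, sub_zero, abs_of_nonneg (hz t)]
  have := (le_max_left (z t - δ / 2) 0).trans_lt (hT t ht)
  linarith

/-- The value l/(1+b) is the fixed point of the recursion for a t/(t+1); the distance to it
contracts with rate 1+b, where the extra 1 comes from the growing denominator. -/
theorem tendsto_div_of_recursion {a c : ℕ → ℝ} {b l : ℝ} (hb : 0 ≤ b)
    (h : ∀ t : ℕ, a (t + 1) = (1 - b / ((t : ℝ) + 1)) * a t + c t)
    (hc : Tendsto c atTop (𝓝 l)) :
    Tendsto (fun t : ℕ => a t / ((t : ℝ) + 1)) atTop (𝓝 (l / (1 + b))) := by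
  have hb1 : (1 : ℝ) + b ≠ 0 := by positivity
  have key : Tendsto (fun t : ℕ => |a t / ((t : ℝ) + 1) - l / (1 + b)|) atTop (𝓝 0) := by
    refine tendsto_zero_of_recursive_le (b := 1 + b) (ε := fun t => |c t - l|) (by positivity)
      (fun t => abs_nonneg _) ?_ ?_
    · filter_upwards [eventually_div_le_one (1 + b)] with t ht
      have h1 : (t : ℝ) + 1 ≠ 0 := by positivity
      have h2 : (t : ℝ) + 2 ≠ 0 := by positivity
      have h3 : a (t + 1) / (((t + 1 : ℕ) : ℝ) + 1) - l / (1 + b) =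
          (1 - (1 + b) / ((t : ℝ) + 2)) * (a t / ((t : ℝ) + 1) - l / (1 + b)) +
            (c t - l) / ((t : ℝ) + 2) := by
        rw [h t]
        push_cast
        rw [show (t : ℝ) + 1 + 1 = t + 2 by ring]
        field_simp
        ring
      rw [h3]
      refine (abs_add_le _ _).trans_eq ?_
      rw [abs_mul, abs_div, abs_of_nonneg (show 0 ≤ 1 - (1 + b) / ((t : ℝ) + 2) by linarith),
        abs_of_nonneg (show 0 ≤ (t : ℝ) + 2 by positivity)]
    · have := (hc.sub_const l).abs
      simpa using this
  have := (tendsto_zero_iff_abs_tendsto_zero _).2 key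
  simpa using this.add_const (l / (1 + b))

theorem tendsto_div_natCast {a : ℕ → ℝ} {l : ℝ}
    (h : Tendsto (fun t : ℕ => a t / ((t : ℝ) + 1)) atTop (𝓝 l)) :
    Tendsto (fun t : ℕ => a t / (t : ℝ)) atTop (𝓝 l) := by
  have h1 : Tendsto (fun t : ℕ => 1 + 1 / (t : ℝ)) atTop (𝓝 (1 + 0)) :=
    tendsto_one_div_atTop_nhds_zero_nat.const_add 1
  have h2 := h.mul h1
  rw [add_zero, mul_one] at h2
  refine h2.congr' ?_
  filter_upwards [eventually_gt_atTop 0] with t ht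
  have : (t : ℝ) ≠ 0 := by positivity
  have h3 : (t : ℝ) + 1 ≠ 0 := by positivity
  field_simp

theorem tendsto_div_zero_of_increment_le {a c : ℕ → ℝ} (ha : ∀ t, 0 ≤ a t)
    (h : ∀ t : ℕ, a (t + 1) ≤ a t + c t) (hc : Tendsto c atTop (𝓝 0)) :
    Tendsto (fun t : ℕ => a t / ((t : ℝ) + 1)) atTop (𝓝 0) := by
  refine tendsto_zero_of_recursive_le (b := 1) (ε := c) one_pos
    (fun t => div_nonneg (ha t) (by positivity)) (Eventually.of_forall fun t => ?_) hc
  have h3 : (1 - 1 / ((t : ℝ) + 2)) * (a t / ((t : ℝ) + 1)) + c t / ((t : ℝ) + 2) =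
      (a t + c t) / ((t : ℝ) + 2) := by
    field_simp
    ring
  rw [h3]
  push_cast
  rw [show (t : ℝ) + 1 + 1 = t + 2 by ring]
  gcongr
  exact h t

/-! ### The limiting frequencies and their asymptotics -/

/-- The limiting frequencies of the degrees. -/
noncomputable def freq (α p : ℝ) : ℕ → ℝ
  | 0 => 0
  | k + 1 => (α * k * freq α p k + if k = 0 then p else 0) / (1 + α * (k + 1))

theorem freq_nonneg {α p : ℝ} (hα : 0 < α) (hp : 0 < p) (k : ℕ) : 0 ≤ freq α p k := by
  induction k with
  | zero => simp [freq]
  | succ k ih =>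
    rw [freq]
    split_ifs <;> positivity

theorem freq_succ_succ (α p : ℝ) (k : ℕ) :
    freq α p (k + 2) = α * (k + 1) * freq α p (k + 1) / (1 + α * (k + 2)) := by
  rw [freq]
  push_cast
  simp
  ring_nf

/-- Iterating the recursion gives freq(k+1) = freq(1) · k!/∏_{j<k}(2+1/α+j). The product in
`Real.GammaSeq` has one more factor, j = k, which the last factor on the right compensates. -/
theorem freq_eq_gammaSeq {α p : ℝ} (hα : 0 < α) (k : ℕ) (hk : 0 < k) :
    freq α p (k + 1) * (k : ℝ) ^ (1 + 1 / α) =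
      freq α p 1 * (Real.GammaSeq (2 + 1 / α) k * ((2 + 1 / α) / k + 1)) := by
  have hprod : ∀ m : ℕ, freq α p (m + 1) * ∏ j ∈ Finset.range m, (2 + 1 / α + j) =
      freq α p 1 * (m.factorial : ℝ) := by
    intro m
    induction m with
    | zero => simp
    | succ m ih =>
      rw [Finset.prod_range_succ, freq_succ_succ, Nat.factorial_succ]
      push_cast
      have h2 : (1 + α * ((m : ℝ) + 2)) ≠ 0 := by positivity
      have h3 : (2 + 1 / α + (m : ℝ)) = (1 + α * ((m : ℝ) + 2)) / α := by field_simp; ring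
      rw [h3]
      have : α * ((m : ℝ) + 1) * freq α p (m + 1) / (1 + α * ((m : ℝ) + 2)) *
          ((∏ j ∈ Finset.range m, (2 + 1 / α + (j : ℝ))) * ((1 + α * ((m : ℝ) + 2)) / α)) =
          ((m : ℝ) + 1) * (freq α p (m + 1) * ∏ j ∈ Finset.range m, (2 + 1 / α + (j : ℝ))) := by
        field_simp
      rw [this, ih]
      ring
  have hk' : (0 : ℝ) < k := by exact_mod_cast hk
  have hP : (0 : ℝ) < ∏ j ∈ Finset.range k, (2 + 1 / α + (j : ℝ)) :=
    Finset.prod_pos fun j _ => by positivity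
  have h1 : freq α p (k + 1) = freq α p 1 * (k.factorial : ℝ) /
      ∏ j ∈ Finset.range k, (2 + 1 / α + (j : ℝ)) := by
    rw [eq_div_iff hP.ne', hprod]
  have h4 : (k : ℝ) ^ (2 + 1 / α) = (k : ℝ) ^ (1 + 1 / α) * k := by
    rw [← Real.rpow_add_one hk'.ne']
    congr 1
    ring
  have h5 : (2 + 1 / α + (k : ℝ)) ≠ 0 := by positivity
  rw [Real.GammaSeq, Finset.prod_range_succ, h1, h4]
  have h6 : (2 + 1 / α) / (k : ℝ) + 1 = (2 + 1 / α + k) / k := by field_simp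
  rw [h6]
  generalize (2 + 1 / α + (k : ℝ)) = q at *
  have := hP.ne'
  generalize (∏ j ∈ Finset.range k, (2 + 1 / α + (j : ℝ))) = P at *
  field_simp

theorem tendsto_succ_div_rpow (b : ℝ) :
    Tendsto (fun k : ℕ => (((k : ℝ) + 1) / k) ^ b) atTop (𝓝 1) := by
  have h1 : Tendsto (fun k : ℕ => 1 + 1 / (k : ℝ)) atTop (𝓝 (1 + 0)) :=
    tendsto_one_div_atTop_nhds_zero_nat.const_add 1
  rw [add_zero] at h1
  have h2 := h1.rpow_const (p := b) (Or.inl one_ne_zero)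
  rw [Real.one_rpow] at h2
  refine h2.congr' ?_
  filter_upwards [eventually_gt_atTop 0] with k hk
  have : (k : ℝ) ≠ 0 := by positivity
  congr 1
  field_simp

/-- The constant of the power law of `freq`. -/
noncomputable def freqConst (α p : ℝ) : ℝ := freq α p 1 * Real.Gamma (2 + 1 / α)

theorem freqConst_pos {α p : ℝ} (hα : 0 < α) (hp : 0 < p) : 0 < freqConst α p := by
  refine mul_pos ?_ (Real.Gamma_pos_of_pos (by positivity))
  simp [freq]
  positivity

theorem tendsto_freq_succ_mul_rpow {α p : ℝ} (hα : 0 < α) :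
    Tendsto (fun k : ℕ => freq α p (k + 1) * (k : ℝ) ^ (1 + 1 / α)) atTop
      (𝓝 (freqConst α p)) := by
  have h1 := Real.GammaSeq_tendsto_Gamma (2 + 1 / α)
  have h2 : Tendsto (fun k : ℕ => (2 + 1 / α) / (k : ℝ) + 1) atTop (𝓝 (0 + 1)) :=
    (tendsto_const_div_atTop_nhds_zero_nat _).add_const 1
  have h3 := (h1.mul h2).const_mul (freq α p 1)
  rw [zero_add, mul_one] at h3
  refine h3.congr' ?_
  filter_upwards [eventually_gt_atTop 0] with k hk
  rw [freq_eq_gammaSeq hα k hk]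

theorem tendsto_freq_mul_rpow {α p : ℝ} (hα : 0 < α) :
    Tendsto (fun k : ℕ => freq α p k * (k : ℝ) ^ (1 + 1 / α)) atTop (𝓝 (freqConst α p)) := by
  rw [← tendsto_add_atTop_iff_nat 1]
  have h := (tendsto_freq_succ_mul_rpow (p := p) hα).mul (tendsto_succ_div_rpow (1 + 1 / α))
  rw [mul_one] at h
  refine h.congr' ?_
  filter_upwards [eventually_gt_atTop 0] with k hk
  have : (0 : ℝ) < k := by positivity
  rw [Real.div_rpow (by positivity) this.le, Nat.cast_add_one, mul_assoc, mul_div_cancel₀]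
  positivity

/-- The recursion is a conservation law: mass p enters at degree 1, and α(k+1)·freq(k+1) is the flow
out of degree k+1. Hence tails are known exactly and need no comparison with an integral. -/
theorem sum_range_freq {α p : ℝ} (hα : 0 < α) (k : ℕ) :
    ∑ j ∈ Finset.range (k + 2), freq α p j = p - α * (k + 1) * freq α p (k + 1) := by
  induction k with
  | zero =>
    simp [Finset.sum_range_succ, freq]
    field_simp
    ring
  | succ k ih =>
    rw [Finset.sum_range_succ, ih, freq_succ_succ]
    have : 1 + α * ((k : ℝ) + 2) ≠ 0 := by positivity
    push_cast
    field_simp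
    ring

theorem tendsto_tail_freq {α p : ℝ} (hα : 0 < α) :
    Tendsto (fun k : ℕ => (p - ∑ j ∈ Finset.range k, freq α p j) * (k : ℝ) ^ (1 / α)) atTop
      (𝓝 (α * freqConst α p)) := by
  rw [← tendsto_add_atTop_iff_nat 1, ← tendsto_add_atTop_iff_nat 1]
  have h := ((tendsto_freq_mul_rpow (p := p) hα).comp (tendsto_add_atTop_nat 1)).const_mul α
  have h' := h.mul ((tendsto_succ_div_rpow (1 / α)).comp (tendsto_add_atTop_nat 1))
  rw [mul_one] at h'
  refine h'.congr fun k => ?_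
  have hk : (0 : ℝ) < (k : ℝ) + 1 := by positivity
  simp only [Function.comp_apply]
  rw [show k + 1 + 1 = k + 2 from rfl, sum_range_freq hα]
  push_cast
  rw [Real.div_rpow (by positivity) hk.le, Real.rpow_add hk, Real.rpow_one,
    show (k : ℝ) + 1 + 1 = k + 2 by ring]
  field_simp
  ring

theorem hasSum_freq {α p : ℝ} (hα : 0 < α) (hp : 0 < p) : HasSum (freq α p) p := by
  rw [hasSum_iff_tendsto_nat_of_nonneg (freq_nonneg hα hp)]
  have h1 := tendsto_tail_freq (p := p) hα
  have h2 : Tendsto (fun k : ℕ => (k : ℝ) ^ (-(1 / α))) atTop (𝓝 0) :=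
    (tendsto_rpow_neg_atTop (by positivity)).comp tendsto_natCast_atTop_atTop
  have h3 := (h1.mul h2).const_sub p
  rw [mul_zero, sub_zero] at h3
  refine h3.congr' ?_
  filter_upwards [eventually_gt_atTop 0] with k hk
  have : (0 : ℝ) < k := by positivity
  rw [mul_assoc, ← Real.rpow_add this, add_neg_cancel, Real.rpow_zero]
  ring

/-! ### Power laws on the multiples of an integer -/

/-- The sequence `M`, moved to the multiples of `s`. -/
noncomputable def spread (s : ℕ) (M : ℕ → ℝ) (j : ℕ) : ℝ := if s ∣ j then M (j / s) else 0

theorem spread_mul {s : ℕ} (hs : 0 < s) (M : ℕ → ℝ) (k : ℕ) : spread s M (s * k) = M k := by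
  rw [spread, if_pos (dvd_mul_right s k), Nat.mul_div_cancel_left k hs]

theorem hasSum_spread {s : ℕ} (hs : 0 < s) {M : ℕ → ℝ} {p : ℝ} (h : HasSum M p) :
    HasSum (spread s M) p := by
  have hinj : Function.Injective fun k : ℕ => s * k := fun a b h => Nat.eq_of_mul_eq_mul_left hs h
  rw [← hinj.hasSum_iff]
  · exact h.congr_fun fun k => spread_mul hs M k
  · intro j hj
    rw [spread, if_neg]
    rintro ⟨k, rfl⟩
    exact hj ⟨k, rfl⟩

/-- The multiples of s below k are s·i with i < ⌈k/s⌉, so tails at k become tails of M at ⌈k/s⌉. -/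
theorem sum_range_spread {s : ℕ} (hs : 0 < s) (M : ℕ → ℝ) (k : ℕ) :
    ∑ j ∈ Finset.range k, spread s M j = ∑ i ∈ Finset.range (k ⌈/⌉ s), M i := by
  have h1 : ∑ i ∈ Finset.range (k ⌈/⌉ s), M i =
      ∑ j ∈ (Finset.range (k ⌈/⌉ s)).image (s * ·), spread s M j := by
    rw [Finset.sum_image fun a _ b _ h => Nat.eq_of_mul_eq_mul_left hs h]
    exact Finset.sum_congr rfl fun i _ => (spread_mul hs M i).symm
  have hlt : ∀ i, i < k ⌈/⌉ s ↔ s * i < k := fun i => by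
    rw [← not_le, ← not_le, ceilDiv_le_iff_le_mul hs]
  rw [h1]
  refine (Finset.sum_subset ?_ ?_).symm
  · intro j hj
    obtain ⟨i, hi, rfl⟩ := Finset.mem_image.1 hj
    exact Finset.mem_range.2 ((hlt i).1 (Finset.mem_range.1 hi))
  · intro j hj hj'
    rw [spread, if_neg]
    rintro ⟨i, rfl⟩
    exact hj' (Finset.mem_image.2 ⟨i, Finset.mem_range.2 ((hlt i).2 (Finset.mem_range.1 hj)), rfl⟩)

theorem tendsto_ceilDiv {s : ℕ} (hs : 0 < s) :
    Tendsto (fun k : ℕ => k ⌈/⌉ s) atTop atTop := by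
  refine tendsto_atTop_mono (fun k => ?_) (Nat.tendsto_div_const_atTop hs.ne')
  rw [Nat.ceilDiv_eq_add_pred_div]
  exact Nat.div_le_div_right (by omega)

theorem tendsto_ceilDiv_div {s : ℕ} (hs : 0 < s) :
    Tendsto (fun k : ℕ => (k : ℝ) / ((k ⌈/⌉ s : ℕ) : ℝ)) atTop (𝓝 s) := by
  have h1 : Tendsto (fun k : ℕ => (s : ℝ) - s / ((k ⌈/⌉ s : ℕ) : ℝ)) atTop (𝓝 (s - 0)) :=
    ((tendsto_const_div_atTop_nhds_zero_nat (s : ℝ)).comp (tendsto_ceilDiv hs)).const_sub _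
  rw [sub_zero] at h1
  refine tendsto_of_tendsto_of_tendsto_of_le_of_le' h1 tendsto_const_nhds ?_ ?_
  · filter_upwards [(tendsto_ceilDiv hs).eventually_gt_atTop 0] with k hk
    have hk' : (0 : ℝ) < ((k ⌈/⌉ s : ℕ) : ℝ) := by exact_mod_cast hk
    have h2 : s * (k ⌈/⌉ s) ≤ k + s := by
      rw [Nat.ceilDiv_eq_add_pred_div]
      have := Nat.mul_div_le (k + s - 1) s
      omega
    have h3 : (s : ℝ) * ((k ⌈/⌉ s : ℕ) : ℝ) ≤ k + s := by exact_mod_cast h2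
    rw [le_div_iff₀ hk', sub_mul, div_mul_cancel₀ _ hk'.ne']
    linarith
  · filter_upwards [(tendsto_ceilDiv hs).eventually_gt_atTop 0] with k hk
    have hk' : (0 : ℝ) < ((k ⌈/⌉ s : ℕ) : ℝ) := by exact_mod_cast hk
    rw [div_le_iff₀ hk']
    have h2 : k ≤ s * (k ⌈/⌉ s) := (ceilDiv_le_iff_le_mul hs).1 le_rfl
    exact_mod_cast h2

theorem isPowerLaw_spread_freq {α p : ℝ} (hα : 0 < α) (hp : 0 < p) {s : ℕ} (hs : 0 < s) :
    IsPowerLaw s (spread s (freq α p)) (1 + 1 / α) := by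
  have hs' : (0 : ℝ) < s := by exact_mod_cast hs
  have hsum := hasSum_spread hs (hasSum_freq hα hp)
  refine ⟨hsum.summable, fun k hk => if_neg hk,
    ⟨freqConst α p * (s : ℝ) ^ (1 + 1 / α), mul_pos (freqConst_pos hα hp) (by positivity), ?_⟩,
    ⟨α * freqConst α p * (s : ℝ) ^ (1 / α),
      mul_pos (mul_pos hα (freqConst_pos hα hp)) (by positivity), ?_⟩⟩
  · refine ((tendsto_freq_mul_rpow hα).mul_const _).congr fun k => ?_
    rw [spread_mul hs, Nat.cast_mul, Real.mul_rpow hs'.le k.cast_nonneg]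
    ring
  · have h1 := ((tendsto_tail_freq (p := p) hα).comp (tendsto_ceilDiv hs)).mul
      ((tendsto_ceilDiv_div hs).rpow_const (p := 1 / α) (Or.inl hs'.ne'))
    refine h1.congr' ?_
    filter_upwards [(tendsto_ceilDiv hs).eventually_gt_atTop 0] with k hk
    have hk' : (0 : ℝ) < ((k ⌈/⌉ s : ℕ) : ℝ) := by exact_mod_cast hk
    have h2 : ∑' j, spread s (freq α p) (k + j) =
        p - ∑ j ∈ Finset.range k, spread s (freq α p) j := by
      have h3 := hsum.summable.sum_add_tsum_nat_add k
      rw [hsum.tsum_eq] at h3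
      simp_rw [add_comm k]
      linarith
    simp only [Function.comp_apply]
    rw [h2, sum_range_spread hs, add_sub_cancel_left, mul_assoc,
      Real.div_rpow k.cast_nonneg hk'.le, mul_div_cancel₀]
    positivity

/-! ### Expectations as linear functionals -/

section Functional

variable {β ι : Type*} (L : (β → ℝ) →ₗ[ℝ] ℝ)

theorem apply_add_fun (f g : β → ℝ) : L (fun x => f x + g x) = L f + L g := map_add L f g

theorem apply_sub_fun (f g : β → ℝ) : L (fun x => f x - g x) = L f - L g := map_sub L f g

theorem apply_const_mul (c : ℝ) (f : β → ℝ) : L (fun x => c * f x) = c * L f := map_smul L c f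

theorem apply_sum_fun (s : Finset ι) (F : ι → β → ℝ) :
    L (fun x => ∑ i ∈ s, F i x) = ∑ i ∈ s, L (F i) := by
  rw [← map_sum]
  congr 1
  ext x
  simp

end Functional

/-- The functional `L` is the expectation with respect to the finitely supported `q`. -/
def Represents {α : Type*} (q : PMF α) (L : (α → ℝ) →ₗ[ℝ] ℝ) : Prop :=
  ∃ F : Finset α, (∀ a ∉ F, q a = 0) ∧ ∀ f, L f = ∑ a ∈ F, (q a).toReal * f a

/-- Finite support makes every real function integrable, so from here on expectations can be handled
by linearity and positivity alone. -/
theorem Represents.integral_eq {α : Type*} [MeasurableSpace α] [MeasurableSingletonClass α]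
    {q : PMF α} {L : (α → ℝ) →ₗ[ℝ] ℝ} (h : Represents q L) (f : α → ℝ) :
    ∫ a, f a ∂q.toMeasure = L f := by
  obtain ⟨F, hF, hL⟩ := h
  have hae : q.toMeasure = q.toMeasure.restrict (F : Set α) := by
    refine (Measure.restrict_eq_self_of_ae_mem ?_).symm
    rw [ae_iff]
    change q.toMeasure (F : Set α)ᶜ = 0
    rw [PMF.toMeasure_apply_eq_zero_iff _ (F.finite_toSet.measurableSet.compl)]
    rw [Set.disjoint_left]
    intro a ha ha'
    exact (q.mem_support_iff a).1 ha (hF a ha')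
  rw [hae, setIntegral_finset _ .finset, hL]
  refine Finset.sum_congr rfl fun a _ => ?_
  rw [Measure.real, PMF.toMeasure_apply_singleton _ _ (measurableSet_singleton a), smul_eq_mul]

theorem represents_pure {α : Type*} (a : α) :
    Represents (PMF.pure a) (LinearMap.proj a : (α → ℝ) →ₗ[ℝ] ℝ) := by
  refine ⟨{a}, fun b hb => ?_, fun f => ?_⟩
  · rw [PMF.pure_apply, if_neg]
    simpa using hb
  · simp

theorem Represents.bind {α β : Type*} {q : PMF α} {L : (α → ℝ) →ₗ[ℝ] ℝ} (hq : Represents q L)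
    {g : α → PMF β} {K : α → (β → ℝ) →ₗ[ℝ] ℝ} (hg : ∀ a, Represents (g a) (K a)) :
    Represents (q.bind g) (L ∘ₗ LinearMap.pi K) := by
  classical
  obtain ⟨F, hF, hL⟩ := hq
  choose G hG hK using hg
  have hb : ∀ b, (q.bind g) b = ∑ a ∈ F, q a * g a b := fun b => by
    rw [PMF.bind_apply, tsum_eq_sum]
    intro a ha
    rw [hF a ha, zero_mul]
  refine ⟨F.biUnion G, fun b hb' => ?_, fun f => ?_⟩
  · rw [hb]
    refine Finset.sum_eq_zero fun a ha => ?_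
    rw [hG a b fun h => hb' (Finset.mem_biUnion.2 ⟨a, ha, h⟩), mul_zero]
  · have h1 : ∀ b, ((q.bind g) b).toReal = ∑ a ∈ F, (q a).toReal * (g a b).toReal := fun b => by
      rw [hb, ENNReal.toReal_sum fun a _ =>
        ENNReal.mul_ne_top (PMF.apply_ne_top _ _) (PMF.apply_ne_top _ _)]
      simp_rw [ENNReal.toReal_mul]
    simp_rw [h1, Finset.sum_mul]
    rw [Finset.sum_comm, LinearMap.comp_apply, hL]
    refine Finset.sum_congr rfl fun a ha => ?_
    rw [LinearMap.pi_apply, hK, Finset.mul_sum]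
    simp_rw [mul_assoc]
    refine Finset.sum_subset (Finset.subset_biUnion_of_mem G ha) fun b _ hb' => ?_
    rw [hG a b hb']
    simp

theorem Represents.map {α β : Type*} {q : PMF α} {L : (α → ℝ) →ₗ[ℝ] ℝ} (hq : Represents q L)
    (g : α → β) : Represents (q.map g) (L ∘ₗ LinearMap.funLeft ℝ ℝ g) := by
  have := hq.bind fun a => represents_pure (g a)
  exact this

theorem represents_fintype {α : Type*} [Fintype α] (q : PMF α) :
    Represents q (∑ a, (q a).toReal • (LinearMap.proj a : (α → ℝ) →ₗ[ℝ] ℝ)) :=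
  ⟨Finset.univ, fun a ha => absurd (Finset.mem_univ a) ha, fun f => by simp⟩

/-! ### Independent draws: hits, joint hits and repetitions -/

/-- The expectation over the multisets of the outcomes of `k` draws with probabilities `w`. -/
noncomputable def drawsE {α : Type*} [Fintype α] (w : α → ℝ) : ℕ → ((Multiset α → ℝ) →ₗ[ℝ] ℝ)
  | 0 => LinearMap.proj 0
  | k + 1 => ∑ a, w a • (drawsE w k ∘ₗ LinearMap.funLeft ℝ ℝ (fun s => a ::ₘ s))

section Draws

variable {α : Type*} [Fintype α]

theorem drawsE_zero (w : α → ℝ) (f : Multiset α → ℝ) : drawsE w 0 f = f 0 := rfl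

theorem drawsE_succ (w : α → ℝ) (k : ℕ) (f : Multiset α → ℝ) :
    drawsE w (k + 1) f = ∑ a, w a * drawsE w k (fun s => f (a ::ₘ s)) := by
  simp [drawsE, LinearMap.funLeft, Function.comp_def]

theorem represents_draws (q : PMF α) (k : ℕ) :
    Represents (draws q k) (drawsE (fun a => (q a).toReal) k) := by
  induction k with
  | zero => exact represents_pure 0
  | succ k ih =>
    have h := (represents_fintype q).bind fun a => ih.map (fun s => a ::ₘ s)
    have e : drawsE (fun a => (q a).toReal) (k + 1) =
        (∑ a, (q a).toReal • (LinearMap.proj a : (α → ℝ) →ₗ[ℝ] ℝ)) ∘ₗ LinearMap.pi fun a =>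
          drawsE (fun a => (q a).toReal) k ∘ₗ LinearMap.funLeft ℝ ℝ fun s => a ::ₘ s :=
      LinearMap.ext fun f => by simp [drawsE]
    rw [e]
    exact h

variable {w : α → ℝ}

theorem drawsE_mono (hw : ∀ a, 0 ≤ w a) {k : ℕ} {f g : Multiset α → ℝ}
    (h : ∀ s, s.card = k → f s ≤ g s) : drawsE w k f ≤ drawsE w k g := by
  induction k generalizing f g with
  | zero => exact h 0 rfl
  | succ k ih =>
    rw [drawsE_succ, drawsE_succ]
    refine Finset.sum_le_sum fun a _ => mul_le_mul_of_nonneg_left (ih fun s hs => ?_) (hw a)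
    exact h _ (by rw [Multiset.card_cons, hs])

theorem drawsE_const (hw1 : ∑ a, w a = 1) (k : ℕ) (c : ℝ) : drawsE w k (fun _ => c) = c := by
  induction k with
  | zero => rfl
  | succ k ih => rw [drawsE_succ, ih, ← Finset.sum_mul, hw1, one_mul]

/-- The probability that `k` draws hit an element of probability `x`. -/
def hit (k : ℕ) (x : ℝ) : ℝ := 1 - (1 - x) ^ k

theorem hit_le {x : ℝ} (h1 : x ≤ 1) (k : ℕ) : hit k x ≤ k * x := by
  have := one_add_mul_le_pow (a := -x) (by linarith) k
  rw [hit, sub_eq_add_neg 1 x]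
  linarith

/-- The second-order Bonferroni bound, with a generous constant. -/
theorem le_hit {x : ℝ} (h0 : 0 ≤ x) (h1 : x ≤ 1) (k : ℕ) : k * x - k ^ 2 * x ^ 2 ≤ hit k x := by
  induction k with
  | zero => simp [hit]
  | succ k ih =>
    have h2 : hit (k + 1) x = hit k x + x * (1 - hit k x) := by
      simp only [hit, pow_succ]
      ring
    have h3 := mul_le_mul_of_nonneg_left (hit_le h1 k) h0
    have h4 : 0 ≤ (k : ℝ) * x ^ 2 := by positivity
    rw [h2]
    push_cast
    nlinarith [sq_nonneg x]

theorem hit_eq_mul_sum (k : ℕ) (x : ℝ) : hit k x = x * ∑ i ∈ Finset.range k, (1 - x) ^ i := by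
  have := mul_neg_geom_sum (1 - x) k
  rw [hit, ← this]
  ring

/-- The quotient hit(x)/x is a geometric sum in 1-x, hence decreasing in x. The inequality is
cleared of denominators so that weight 0 needs no separate case. -/
theorem hit_chebyshev_aux (k : ℕ) {x y : ℝ} (hx : 0 ≤ x) (hy : 0 ≤ y) (hx1 : x ≤ 1) (hy1 : y ≤ 1) :
    (x - y) * (y * hit k x - x * hit k y) ≤ 0 := by
  have mono : ∀ {x y : ℝ}, 0 ≤ x → x ≤ y → y ≤ 1 →
      ∑ i ∈ Finset.range k, (1 - y) ^ i ≤ ∑ i ∈ Finset.range k, (1 - x) ^ i :=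
    fun h0 h h1 => Finset.sum_le_sum fun i _ => pow_le_pow_left₀ (by linarith) (by linarith) i
  have h : (x - y) * (y * hit k x - x * hit k y) = (x * y) * ((x - y) *
      (∑ i ∈ Finset.range k, (1 - x) ^ i - ∑ i ∈ Finset.range k, (1 - y) ^ i)) := by
    rw [hit_eq_mul_sum, hit_eq_mul_sum]
    ring
  rw [h]
  refine mul_nonpos_of_nonneg_of_nonpos (mul_nonneg hx hy) ?_
  rcases le_total x y with hxy | hxy
  · exact mul_nonpos_of_nonpos_of_nonneg (by linarith) (by linarith [mono hx hxy hy1])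
  · exact mul_nonpos_of_nonneg_of_nonpos (by linarith) (by linarith [mono hy hxy hx1])

theorem le_one_of_sum_eq_one (hw : ∀ a, 0 ≤ w a) (hw1 : ∑ a, w a = 1) (a : α) : w a ≤ 1 := by
  rw [← hw1]
  exact Finset.single_le_sum (fun b _ => hw b) (Finset.mem_univ a)

/-- Chebyshev's sum inequality under the probability w, for the increasing function w and the
decreasing function hit(w)/w. It says that heavy vertices are under-represented among the distinct
members of a hyperedge, so drawing does not favour concentration. -/
theorem sum_mul_hit_le (hw : ∀ a, 0 ≤ w a) (hw1 : ∑ a, w a = 1) (k : ℕ) :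
    ∑ a, w a * hit k (w a) ≤ (∑ a, w a ^ 2) * ∑ a, hit k (w a) := by
  have h1 : ∑ a, ∑ b, (w a - w b) * (w b * hit k (w a) - w a * hit k (w b)) =
      2 * (∑ a, w a * hit k (w a) - (∑ a, w a ^ 2) * ∑ a, hit k (w a)) := by
    have e : ∀ a b, (w a - w b) * (w b * hit k (w a) - w a * hit k (w b)) =
        (w a * hit k (w a)) * w b + w a * (w b * hit k (w b)) - hit k (w a) * w b ^ 2
          - w a ^ 2 * hit k (w b) := fun a b => by ring
    simp_rw [e, Finset.sum_sub_distrib, Finset.sum_add_distrib, ← Finset.sum_mul_sum]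
    rw [hw1]
    ring
  have h2 : ∑ a, ∑ b, (w a - w b) * (w b * hit k (w a) - w a * hit k (w b)) ≤ 0 :=
    Finset.sum_nonpos fun a _ => Finset.sum_nonpos fun b _ =>
      hit_chebyshev_aux k (hw a) (hw b) (le_one_of_sum_eq_one hw hw1 a)
        (le_one_of_sum_eq_one hw hw1 b)
  linarith

variable [DecidableEq α]

theorem drawsE_notMem (hw1 : ∑ a, w a = 1) (k : ℕ) (a : α) :
    drawsE w k (fun s => if a ∈ s then 0 else 1) = (1 - w a) ^ k := by
  induction k with
  | zero => simp [drawsE_zero]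
  | succ k ih =>
    rw [drawsE_succ]
    have h : ∀ b, w b * drawsE w k (fun s => if a ∈ b ::ₘ s then (0 : ℝ) else 1) =
        w b * (1 - w a) ^ k - if b = a then w a * (1 - w a) ^ k else 0 := by
      intro b
      by_cases hb : b = a
      · subst hb
        simp only [Multiset.mem_cons, true_or, if_true]
        rw [drawsE_const hw1]
        ring
      · simp only [Multiset.mem_cons, Ne.symm hb, false_or, if_neg hb]
        rw [ih]
        ring
    simp_rw [h, Finset.sum_sub_distrib, ← Finset.sum_mul, hw1]
    simp
    ring

theorem drawsE_mem (hw1 : ∑ a, w a = 1) (k : ℕ) (a : α) :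
    drawsE w k (fun s => if a ∈ s then 1 else 0) = hit k (w a) := by
  have h : (fun s : Multiset α => if a ∈ s then (1 : ℝ) else 0) =
      fun s => 1 - if a ∈ s then (0 : ℝ) else 1 := by
    ext s
    split_ifs <;> simp
  rw [h, apply_sub_fun, drawsE_const hw1, drawsE_notMem hw1, hit]

/-- A union bound over the positions of a and b; the induction uses k² + 2k ≤ (k+1)². -/
theorem drawsE_mem_and_mem_le (hw : ∀ a, 0 ≤ w a) (hw1 : ∑ a, w a = 1) (k : ℕ) {a b : α}
    (hab : a ≠ b) :
    drawsE w k (fun s => if a ∈ s ∧ b ∈ s then 1 else 0) ≤ k ^ 2 * (w a * w b) := by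
  induction k with
  | zero => simp [drawsE_zero]
  | succ k ih =>
    rw [drawsE_succ]
    have h : ∀ c, w c * drawsE w k (fun s => if a ∈ c ::ₘ s ∧ b ∈ c ::ₘ s then (1 : ℝ) else 0) ≤
        w c * (k ^ 2 * (w a * w b)) + ((if c = a then w a * (k * w b) else 0) +
          if c = b then w b * (k * w a) else 0) := by
      intro c
      have hnn : 0 ≤ w c * (k ^ 2 * (w a * w b)) :=
        mul_nonneg (hw c) (mul_nonneg (by positivity) (mul_nonneg (hw a) (hw b)))
      by_cases hca : c = a
      · subst hca
        simp only [Multiset.mem_cons, true_or, true_and, Ne.symm hab, false_or, if_true, if_neg hab]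
        rw [drawsE_mem hw1]
        have := mul_le_mul_of_nonneg_left (hit_le (le_one_of_sum_eq_one hw hw1 b) k) (hw c)
        linarith
      · by_cases hcb : c = b
        · subst hcb
          simp only [Multiset.mem_cons, true_or, and_true, hab, false_or, if_true, if_neg hca]
          rw [drawsE_mem hw1]
          have := mul_le_mul_of_nonneg_left (hit_le (le_one_of_sum_eq_one hw hw1 a) k) (hw c)
          linarith
        · simp only [Multiset.mem_cons, Ne.symm hca, Ne.symm hcb, false_or, if_neg hca, if_neg hcb]
          have := mul_le_mul_of_nonneg_left ih (hw c)
          linarith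
    refine (Finset.sum_le_sum fun c _ => h c).trans ?_
    simp_rw [Finset.sum_add_distrib, ← Finset.sum_mul, hw1]
    simp
    have := mul_nonneg (hw a) (hw b)
    nlinarith

theorem drawsE_sum_mem (hw1 : ∑ a, w a = 1) (k : ℕ) (c : α → ℝ) :
    drawsE w k (fun s => ∑ a, c a * if a ∈ s then 1 else 0) = ∑ a, c a * hit k (w a) := by
  rw [apply_sum_fun]
  refine Finset.sum_congr rfl fun a _ => ?_
  rw [apply_const_mul, drawsE_mem hw1]

theorem card_toFinset_eq_sum (s : Multiset α) :
    (s.toFinset.card : ℝ) = ∑ a, if a ∈ s then 1 else 0 := by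
  rw [Finset.sum_boole]
  congr 2
  ext a
  simp

theorem drawsE_card_toFinset (hw1 : ∑ a, w a = 1) (k : ℕ) :
    drawsE w k (fun s => (s.toFinset.card : ℝ)) = ∑ a, hit k (w a) := by
  have := drawsE_sum_mem hw1 k fun _ => 1
  simp only [one_mul] at this
  rw [← this]
  congr 1
  ext s
  exact card_toFinset_eq_sum s

theorem drawsE_sub_card_toFinset_le (hw : ∀ a, 0 ≤ w a) (hw1 : ∑ a, w a = 1) (k : ℕ) :
    drawsE w k (fun s => (k : ℝ) - s.toFinset.card) ≤ k ^ 2 * ∑ a, w a ^ 2 := by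
  rw [apply_sub_fun, drawsE_const hw1, drawsE_card_toFinset hw1]
  have h : ∑ a, ((k : ℝ) * w a - k ^ 2 * w a ^ 2) ≤ ∑ a, hit k (w a) :=
    Finset.sum_le_sum fun a _ => le_hit (hw a) (le_one_of_sum_eq_one hw hw1 a) k
  rw [Finset.sum_sub_distrib, ← Finset.mul_sum, ← Finset.mul_sum, hw1] at h
  linarith

end Draws

/-! ### Degree sums and their change when a hyperedge is added -/

namespace MultiHypergraph

variable (H : MultiHypergraph)

/-- The sum of `F` over the degrees of the vertices. -/
def degSum (F : ℕ → ℝ) : ℝ := ∑ v : Fin H.n, F (H.degree v)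

/-- The sum of the degrees of the vertices. -/
def totalDegree : ℝ := H.degSum fun k => k

/-- The probability with which a vertex is drawn. -/
noncomputable def weight (v : Fin H.n) : ℝ := H.degree v / H.totalDegree

/-- The probability that two draws give the same vertex. -/
noncomputable def collision : ℝ := ∑ v, H.weight v ^ 2

theorem totalDegree_eq : H.totalDegree = ∑ v : Fin H.n, (H.degree v : ℝ) := rfl

theorem totalDegree_nonneg : 0 ≤ H.totalDegree := by
  rw [totalDegree_eq]
  positivity

theorem weight_nonneg (v : Fin H.n) : 0 ≤ H.weight v :=
  div_nonneg (Nat.cast_nonneg _) H.totalDegree_nonneg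

theorem toReal_preferentialVertex (v : Fin H.n) :
    (H.preferentialVertex v).toReal = H.weight v := by
  rw [preferentialVertex, PMF.normalize_apply, ENNReal.toReal_mul, ENNReal.toReal_inv, tsum_fintype,
    ENNReal.toReal_sum fun _ _ => ENNReal.natCast_ne_top _]
  simp [weight, totalDegree_eq, div_eq_mul_inv]

variable {H}

theorem sum_weight (h : 0 < H.totalDegree) : ∑ v, H.weight v = 1 := by
  simp_rw [weight]
  rw [← Finset.sum_div, ← totalDegree_eq, div_self h.ne']

theorem collision_eq : H.collision = H.degSum (fun k => (k : ℝ) ^ 2) / H.totalDegree ^ 2 := by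
  simp_rw [collision, weight, div_pow, ← Finset.sum_div, degSum]

variable (H)

theorem collision_nonneg : 0 ≤ H.collision := Finset.sum_nonneg fun _ _ => sq_nonneg _

theorem collision_le_one : H.collision ≤ 1 := by
  rcases H.totalDegree_nonneg.eq_or_lt with h | h
  · simp [collision, weight, ← h]
  · rw [← sum_weight h]
    refine Finset.sum_le_sum fun v _ => ?_
    have := le_one_of_sum_eq_one H.weight_nonneg (sum_weight h) v
    nlinarith [H.weight_nonneg v]

theorem mem_map_val {s : Multiset (Fin H.n)} {v : Fin H.n} : (v : ℕ) ∈ s.map Fin.val ↔ v ∈ s :=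
  Multiset.mem_map_of_injective Fin.val_injective

theorem degree_n : H.degree H.n = 0 := by
  rw [degree, Multiset.countP_eq_zero]
  intro e he h
  exact (H.incidence e he _ h).ne rfl

theorem degree_addEdge (s : Multiset (Fin H.n)) (v : Fin H.n) :
    (H.addEdge s).degree v = H.degree v + if v ∈ s then 1 else 0 := by
  simp only [degree, addEdge, Multiset.countP_cons, mem_map_val]

theorem degree_addVertexEdge (s : Multiset (Fin H.n)) (v : Fin H.n) :
    (H.addVertexEdge s).degree v = H.degree v + if v ∈ s then 1 else 0 := by
  simp only [degree, addVertexEdge, Multiset.countP_cons, Multiset.mem_cons, mem_map_val,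
    v.isLt.ne, false_or]

theorem degree_addVertexEdge_n (s : Multiset (Fin H.n)) :
    (H.addVertexEdge s).degree H.n = 1 := by
  have := H.degree_n
  simp only [degree, addVertexEdge, Multiset.countP_cons, Multiset.mem_cons, true_or, if_true]
    at this ⊢
  omega

/-- The increase of `degSum F` at the old vertices, if `s` is added. -/
def gain (F : ℕ → ℝ) (s : Multiset (Fin H.n)) : ℝ :=
  ∑ v : Fin H.n, (F (H.degree v + 1) - F (H.degree v)) * if v ∈ s then 1 else 0

theorem degSum_addEdge (F : ℕ → ℝ) (s : Multiset (Fin H.n)) :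
    (H.addEdge s).degSum F = H.degSum F + H.gain F s := by
  have h : (H.addEdge s).degSum F = ∑ v : Fin H.n, F ((H.addEdge s).degree v) := rfl
  rw [h, degSum, gain, ← Finset.sum_add_distrib]
  refine Finset.sum_congr rfl fun v _ => ?_
  rw [degree_addEdge]
  split_ifs <;> simp

theorem degSum_addVertexEdge (F : ℕ → ℝ) (s : Multiset (Fin H.n)) :
    (H.addVertexEdge s).degSum F = H.degSum F + H.gain F s + F 1 := by
  have h : (H.addVertexEdge s).degSum F =
    ∑ v : Fin (H.n + 1), F ((H.addVertexEdge s).degree v) := rfl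
  rw [h, Fin.sum_univ_castSucc, degSum, gain, ← Finset.sum_add_distrib]
  simp only [Fin.val_castSucc, Fin.val_last, degree_addVertexEdge_n]
  congr 1
  refine Finset.sum_congr rfl fun v _ => ?_
  rw [degree_addVertexEdge]
  split_ifs <;> simp

theorem gain_natCast (s : Multiset (Fin H.n)) : H.gain (fun k => k) s = s.toFinset.card := by
  simp [gain, card_toFinset_eq_sum]

theorem totalDegree_addEdge (s : Multiset (Fin H.n)) :
    (H.addEdge s).totalDegree = H.totalDegree + s.toFinset.card := by
  rw [totalDegree, degSum_addEdge, gain_natCast, totalDegree]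

theorem totalDegree_addVertexEdge (s : Multiset (Fin H.n)) :
    (H.addVertexEdge s).totalDegree = H.totalDegree + s.toFinset.card + 1 := by
  rw [totalDegree, degSum_addVertexEdge, gain_natCast, totalDegree, Nat.cast_one]

/-- The sum of the degrees of the members of `s`. -/
def memberDegree (s : Multiset (Fin H.n)) : ℝ :=
  ∑ v : Fin H.n, (H.degree v : ℝ) * if v ∈ s then 1 else 0

theorem memberDegree_nonneg (s : Multiset (Fin H.n)) : 0 ≤ H.memberDegree s :=
  Finset.sum_nonneg fun v _ => by positivity

theorem memberDegree_le (s : Multiset (Fin H.n)) : H.memberDegree s ≤ H.totalDegree :=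
  Finset.sum_le_sum fun v _ => by split_ifs <;> simp

theorem gain_sq (s : Multiset (Fin H.n)) :
    H.gain (fun k => (k : ℝ) ^ 2) s = 2 * H.memberDegree s + s.toFinset.card := by
  rw [gain, memberDegree, card_toFinset_eq_sum, Finset.mul_sum, ← Finset.sum_add_distrib]
  refine Finset.sum_congr rfl fun v _ => ?_
  push_cast
  ring

end MultiHypergraph

open MultiHypergraph

/-- First-order expansion of the collision probability Q/S² after one step: N is the increase of S,
and 2A + N that of the sum of squares Q. It rests on 1/(S+N)² ≤ (S² - 2NS + 3N²)/S⁴. -/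
theorem add_div_sq_le {S Q A N d : ℝ} (hS : 1 ≤ S) (hQ : 0 ≤ Q) (hQS : Q ≤ S ^ 2) (hA : 0 ≤ A)
    (hAS : A ≤ S) (hN : 0 ≤ N) (hNd : N ≤ d) (hd : 1 ≤ d) :
    (Q + 2 * A + N) / (S + N) ^ 2 ≤
      Q / S ^ 2 - 2 * N * (Q / S ^ 2) / S + 2 * (A / S) / S + 13 * d ^ 3 / S ^ 2 := by
  have hS0 : 0 < S := by linarith
  have h1 : Q / S ^ 2 - 2 * N * (Q / S ^ 2) / S + 2 * (A / S) / S + 13 * d ^ 3 / S ^ 2 =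
      (Q * S ^ 2 - 2 * N * Q * S + 2 * A * S ^ 2 + 13 * d ^ 3 * S ^ 2) / S ^ 4 := by
    field_simp
  have h2 : S ^ 4 ≤ (S ^ 2 - 2 * N * S + 3 * N ^ 2) * (S + N) ^ 2 := by
    have : (S ^ 2 - 2 * N * S + 3 * N ^ 2) * (S + N) ^ 2 = S ^ 4 + 4 * N ^ 3 * S + 3 * N ^ 4 := by
      ring
    have : 0 ≤ 4 * N ^ 3 * S + 3 * N ^ 4 := by positivity
    linarith
  have h3 : 1 ≤ S ^ 2 := one_le_pow₀ hS
  have hN2 : N ^ 2 ≤ d ^ 3 :=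
    (pow_le_pow_left₀ hN hNd 2).trans (pow_le_pow_right₀ hd (by norm_num))
  have hN1 : N ≤ d ^ 3 := hNd.trans (le_self_pow₀ hd (by norm_num))
  have hN3 : N ^ 3 ≤ d ^ 3 := pow_le_pow_left₀ hN hNd 3
  have hAS2 : A ≤ S ^ 2 := by nlinarith
  have h4 : (Q + 2 * A + N) * (S ^ 2 - 2 * N * S + 3 * N ^ 2) ≤
      Q * S ^ 2 - 2 * N * Q * S + 2 * A * S ^ 2 + 13 * d ^ 3 * S ^ 2 := by
    -- These four terms occur with coefficients 3, 6, 1 and 3, whence the constant 13; the remaining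
    -- cross terms are nonpositive.
    have e1 : N ^ 2 * Q ≤ d ^ 3 * S ^ 2 := by gcongr
    have e2 : N ^ 2 * A ≤ d ^ 3 * S ^ 2 := by gcongr
    have e3 : N * S ^ 2 ≤ d ^ 3 * S ^ 2 := by gcongr
    have e4 : N ^ 3 * 1 ≤ d ^ 3 * S ^ 2 := by gcongr
    have e5 : 0 ≤ A * N * S := by positivity
    have e6 : 0 ≤ N ^ 2 * S := by positivity
    linarith
  rw [h1, div_le_div_iff₀ (by positivity) (by positivity)]
  calc (Q + 2 * A + N) * S ^ 4 ≤
      (Q + 2 * A + N) * ((S ^ 2 - 2 * N * S + 3 * N ^ 2) * (S + N) ^ 2) := by gcongr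
    _ = ((Q + 2 * A + N) * (S ^ 2 - 2 * N * S + 3 * N ^ 2)) * (S + N) ^ 2 := by ring
    _ ≤ _ := by gcongr

/-! ### The expectation along the evolution, and bounds that hold surely -/

/-- The expectation after one time step. -/
noncomputable def stepE (d : ℕ) (p : ℝ) (H : MultiHypergraph) : (MultiHypergraph → ℝ) →ₗ[ℝ] ℝ :=
  p • (drawsE H.weight (d - 1) ∘ₗ LinearMap.funLeft ℝ ℝ H.addVertexEdge) +
    (1 - p) • (drawsE H.weight d ∘ₗ LinearMap.funLeft ℝ ℝ H.addEdge)

/-- The expectation at time `t`. -/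
noncomputable def lawE (d : ℕ) (hd : 2 ≤ d) (p : ℝ) : ℕ → ((MultiHypergraph → ℝ) →ₗ[ℝ] ℝ)
  | 0 => LinearMap.proj (initial d hd)
  | t + 1 => lawE d hd p t ∘ₗ LinearMap.pi (stepE d p)

theorem stepE_apply (d : ℕ) (p : ℝ) (H : MultiHypergraph) (f : MultiHypergraph → ℝ) :
    stepE d p H f = p * drawsE H.weight (d - 1) (fun s => f (H.addVertexEdge s)) +
      (1 - p) * drawsE H.weight d (fun s => f (H.addEdge s)) := rfl

theorem lawE_succ (d : ℕ) (hd : 2 ≤ d) (p : ℝ) (t : ℕ) (f : MultiHypergraph → ℝ) :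
    lawE d hd p (t + 1) f = lawE d hd p t (fun H => stepE d p H f) := rfl

theorem represents_step (d : ℕ) (p : ℝ≥0) (hp : p ≤ 1) (H : MultiHypergraph) :
    Represents (step d p hp H) (stepE d p H) := by
  have hw : H.weight = fun v => (H.preferentialVertex v).toReal :=
    funext fun v => (H.toReal_preferentialVertex v).symm
  have h := (represents_fintype (coin p hp)).bind
    (g := fun b => if b then (draws H.preferentialVertex (d - 1)).map H.addVertexEdge
      else (draws H.preferentialVertex d).map H.addEdge)
    (K := fun b => if b then drawsE H.weight (d - 1) ∘ₗ LinearMap.funLeft ℝ ℝ H.addVertexEdge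
      else drawsE H.weight d ∘ₗ LinearMap.funLeft ℝ ℝ H.addEdge) (by
      rintro (_ | _)
      · simp only [Bool.false_eq_true, if_false, hw]
        exact (represents_draws _ _).map _
      · simp only [if_true, hw]
        exact (represents_draws _ _).map _)
  have hp' : (1 - (p : ℝ≥0∞)).toReal = 1 - (p : ℝ) := by
    rw [ENNReal.toReal_sub_of_le (by exact_mod_cast hp) ENNReal.one_ne_top]
    simp
  have e : stepE d p H = (∑ b, (coin p hp b).toReal •
      (LinearMap.proj b : (Bool → ℝ) →ₗ[ℝ] ℝ)) ∘ₗ LinearMap.pi fun b =>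
      if b then drawsE H.weight (d - 1) ∘ₗ LinearMap.funLeft ℝ ℝ H.addVertexEdge
      else drawsE H.weight d ∘ₗ LinearMap.funLeft ℝ ℝ H.addEdge :=
    LinearMap.ext fun f => by simp [stepE, coin, hp']
  rw [e]
  exact h

theorem represents_law (d : ℕ) (hd : 2 ≤ d) (p : ℝ≥0) (hp : p ≤ 1) (t : ℕ) :
    Represents (law d hd p hp t) (lawE d hd p t) := by
  induction t with
  | zero => exact represents_pure _
  | succ t ih => exact ih.bind (represents_step d p hp)

instance : MeasurableSingletonClass MultiHypergraph := ⟨fun _ => trivial⟩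

theorem integral_law (d : ℕ) (hd : 2 ≤ d) (p : ℝ≥0) (hp : p ≤ 1) (t : ℕ)
    (f : MultiHypergraph → ℝ) : ∫ H, f H ∂(law d hd p hp t).toMeasure = lawE d hd p t f :=
  (represents_law d hd p hp t).integral_eq f

/-- Properties that the random hypergraph has at time `t` with certainty. -/
structure IsAt (d t : ℕ) (H : MultiHypergraph) : Prop where
  card_eq : ∀ e ∈ H.edges, e.card = d
  n_le : H.n ≤ t + 1
  le_totalDegree : (t : ℝ) + 1 ≤ H.totalDegree
  totalDegree_le : H.totalDegree ≤ d * ((t : ℝ) + 1)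

namespace IsAt

variable {d t : ℕ} {H : MultiHypergraph}

theorem totalDegree_pos (h : IsAt d t H) : 0 < H.totalDegree :=
  lt_of_lt_of_le (by positivity) h.le_totalDegree

theorem one_le_totalDegree (h : IsAt d t H) : 1 ≤ H.totalDegree :=
  le_trans (by linarith [t.cast_nonneg (α := ℝ)]) h.le_totalDegree

theorem sum_weight (h : IsAt d t H) : ∑ v, H.weight v = 1 :=
  MultiHypergraph.sum_weight h.totalDegree_pos

theorem weight_le_one (h : IsAt d t H) (v : Fin H.n) : H.weight v ≤ 1 :=
  le_one_of_sum_eq_one H.weight_nonneg h.sum_weight v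

theorem initial (d : ℕ) (hd : 2 ≤ d) : IsAt d 0 (initial d hd) := by
  have hdeg : (PrefAttach.initial d hd).degree 0 = 1 := by
    simp only [MultiHypergraph.degree, PrefAttach.initial]
    rw [← Multiset.cons_zero, Multiset.countP_cons, Multiset.countP_zero, if_pos]
    exact Multiset.mem_replicate.2 ⟨by omega, rfl⟩
  have h : (PrefAttach.initial d hd).totalDegree = 1 := by
    have e : (PrefAttach.initial d hd).totalDegree =
      ∑ v : Fin 1, ((PrefAttach.initial d hd).degree v : ℝ) := rfl
    rw [e]
    simp [hdeg]
  refine ⟨fun e he => ?_, le_rfl, ?_, ?_⟩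
  · rw [Multiset.mem_singleton.1 he, Multiset.card_replicate]
  · simp [h]
  · rw [h]
    have : (2 : ℝ) ≤ d := by exact_mod_cast hd
    push_cast
    linarith

theorem addEdge (h : IsAt d t H) (hd : 2 ≤ d) {s : Multiset (Fin H.n)} (hs : s.card = d) :
    IsAt d (t + 1) (H.addEdge s) := by
  refine ⟨fun e he => ?_, h.n_le.trans (Nat.le_succ _), ?_, ?_⟩
  · rcases Multiset.mem_cons.1 he with rfl | he
    · rw [Multiset.card_map, hs]
    · exact h.card_eq e he
  · rw [totalDegree_addEdge]
    have h1 : 1 ≤ s.toFinset.card := by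
      rw [Nat.one_le_iff_ne_zero, Finset.card_ne_zero, Multiset.toFinset_nonempty]
      rintro rfl
      simp at hs
      omega
    have h2 : (1 : ℝ) ≤ s.toFinset.card := by exact_mod_cast h1
    push_cast
    linarith [h.le_totalDegree]
  · rw [totalDegree_addEdge]
    have h2 : (s.toFinset.card : ℝ) ≤ d := by exact_mod_cast (s.toFinset_card_le).trans hs.le
    push_cast
    linarith [h.totalDegree_le]

theorem addVertexEdge (h : IsAt d t H) (hd : 2 ≤ d) {s : Multiset (Fin H.n)}
    (hs : s.card = d - 1) : IsAt d (t + 1) (H.addVertexEdge s) := by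
  refine ⟨fun e he => ?_, Nat.succ_le_succ h.n_le, ?_, ?_⟩
  · rcases Multiset.mem_cons.1 he with rfl | he
    · rw [Multiset.card_cons, Multiset.card_map, hs]
      omega
    · exact h.card_eq e he
  · rw [totalDegree_addVertexEdge]
    push_cast
    linarith [h.le_totalDegree, (s.toFinset.card).cast_nonneg (α := ℝ)]
  · rw [totalDegree_addVertexEdge]
    have h1 : s.toFinset.card + 1 ≤ d := by
      have := s.toFinset_card_le
      omega
    have h2 : (s.toFinset.card : ℝ) + 1 ≤ d := by exact_mod_cast h1
    push_cast
    linarith [h.totalDegree_le]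

end IsAt

/-- Comparing only hypergraphs with `IsAt d t` suffices, because a step preserves this property for
every draw of the right size. -/
theorem lawE_mono {d : ℕ} (hd : 2 ≤ d) {p : ℝ} (hp0 : 0 ≤ p) (hp1 : p ≤ 1) {t : ℕ}
    {f g : MultiHypergraph → ℝ} (h : ∀ H, IsAt d t H → f H ≤ g H) :
    lawE d hd p t f ≤ lawE d hd p t g := by
  induction t generalizing f g with
  | zero => exact h _ (IsAt.initial d hd)
  | succ t ih =>
    rw [lawE_succ, lawE_succ]
    refine ih fun H hH => ?_
    rw [stepE_apply, stepE_apply]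
    refine add_le_add (mul_le_mul_of_nonneg_left (drawsE_mono H.weight_nonneg fun s hs => ?_) hp0)
      (mul_le_mul_of_nonneg_left (drawsE_mono H.weight_nonneg fun s hs => ?_) (by linarith))
    · exact h _ (hH.addVertexEdge hd hs)
    · exact h _ (hH.addEdge hd hs)

theorem lawE_congr {d : ℕ} (hd : 2 ≤ d) {p : ℝ} (hp0 : 0 ≤ p) (hp1 : p ≤ 1) {t : ℕ}
    {f g : MultiHypergraph → ℝ} (h : ∀ H, IsAt d t H → f H = g H) :
    lawE d hd p t f = lawE d hd p t g :=
  le_antisymm (lawE_mono hd hp0 hp1 fun H hH => (h H hH).le)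
    (lawE_mono hd hp0 hp1 fun H hH => (h H hH).ge)

theorem stepE_const {d t : ℕ} (p : ℝ) {H : MultiHypergraph} (hH : IsAt d t H) (c : ℝ) :
    stepE d p H (fun _ => c) = c := by
  rw [stepE_apply, drawsE_const hH.sum_weight, drawsE_const hH.sum_weight]
  ring

theorem lawE_const {d : ℕ} (hd : 2 ≤ d) {p : ℝ} (hp0 : 0 ≤ p) (hp1 : p ≤ 1) (t : ℕ) (c : ℝ) :
    lawE d hd p t (fun _ => c) = c := by
  induction t with
  | zero => rfl
  | succ t ih => rw [lawE_succ, lawE_congr hd hp0 hp1 fun H hH => stepE_const p hH c, ih]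

theorem lawE_nonneg {d : ℕ} (hd : 2 ≤ d) {p : ℝ} (hp0 : 0 ≤ p) (hp1 : p ≤ 1) {t : ℕ}
    {f : MultiHypergraph → ℝ} (h : ∀ H, IsAt d t H → 0 ≤ f H) : 0 ≤ lawE d hd p t f := by
  rw [← lawE_const hd hp0 hp1 t 0]
  exact lawE_mono hd hp0 hp1 h

theorem abs_lawE_le {d : ℕ} (hd : 2 ≤ d) {p : ℝ} (hp0 : 0 ≤ p) (hp1 : p ≤ 1) {t : ℕ}
    {f g : MultiHypergraph → ℝ} (h : ∀ H, IsAt d t H → |f H| ≤ g H) :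
    |lawE d hd p t f| ≤ lawE d hd p t g := by
  rw [abs_le, ← map_neg]
  exact ⟨lawE_mono hd hp0 hp1 fun H hH => (abs_le.1 (h H hH)).1,
    lawE_mono hd hp0 hp1 fun H hH => (abs_le.1 (h H hH)).2⟩

/-! ### Drift of the collision probability and of the total degree -/

/-- The probability that a vertex drawn with probability `x` is in the new hyperedge. -/
def edgeHit (d : ℕ) (p x : ℝ) : ℝ := p * hit (d - 1) x + (1 - p) * hit d x

section Step

variable {d t : ℕ} {p : ℝ} {H : MultiHypergraph}

theorem drawsE_gain (hH : IsAt d t H) (k : ℕ) (F : ℕ → ℝ) :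
    drawsE H.weight k (H.gain F) =
      ∑ v : Fin H.n, (F (H.degree v + 1) - F (H.degree v)) * hit k (H.weight v) :=
  drawsE_sum_mem hH.sum_weight k _

theorem stepE_degSum (hH : IsAt d t H) (F : ℕ → ℝ) :
    stepE d p H (fun H' => H'.degSum F) = H.degSum F + p * F 1 +
      ∑ v : Fin H.n, (F (H.degree v + 1) - F (H.degree v)) * edgeHit d p (H.weight v) := by
  have h : ∑ v : Fin H.n, (F (H.degree v + 1) - F (H.degree v)) * edgeHit d p (H.weight v) =
      p * drawsE H.weight (d - 1) (H.gain F) + (1 - p) * drawsE H.weight d (H.gain F) := by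
    rw [drawsE_gain hH, drawsE_gain hH, Finset.mul_sum, Finset.mul_sum, ← Finset.sum_add_distrib]
    refine Finset.sum_congr rfl fun v _ => ?_
    rw [edgeHit]
    ring
  rw [stepE_apply, h]
  simp_rw [degSum_addEdge, degSum_addVertexEdge]
  rw [apply_add_fun _ (fun s => H.degSum F + H.gain F s) (fun _ => F 1),
    apply_add_fun _ (fun _ => H.degSum F) (H.gain F),
    apply_add_fun _ (fun _ => H.degSum F) (H.gain F), drawsE_const hH.sum_weight,
    drawsE_const hH.sum_weight, drawsE_const hH.sum_weight]
  ring

theorem edgeHit_le (hd : 2 ≤ d) (hp0 : 0 ≤ p) (hp1 : p ≤ 1) {x : ℝ} (h1 : x ≤ 1) :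
    edgeHit d p x ≤ (d - p) * x := by
  have h2 := mul_le_mul_of_nonneg_left (hit_le h1 (d - 1)) hp0
  have h3 := mul_le_mul_of_nonneg_left (hit_le h1 d) (sub_nonneg.2 hp1)
  rw [Nat.cast_sub (by omega), Nat.cast_one] at h2
  rw [edgeHit]
  linarith

theorem le_edgeHit (hd : 2 ≤ d) (hp0 : 0 ≤ p) (hp1 : p ≤ 1) {x : ℝ} (h0 : 0 ≤ x) (h1 : x ≤ 1) :
    (d - p) * x - d ^ 2 * x ^ 2 ≤ edgeHit d p x := by
  have h2 := mul_le_mul_of_nonneg_left (le_hit h0 h1 (d - 1)) hp0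
  have h3 := mul_le_mul_of_nonneg_left (le_hit h0 h1 d) (sub_nonneg.2 hp1)
  have h4 : (((d - 1 : ℕ) : ℝ)) ^ 2 * x ^ 2 ≤ d ^ 2 * x ^ 2 := by
    gcongr
    exact Nat.sub_le d 1
  have h5 := mul_le_mul_of_nonneg_left h4 hp0
  rw [Nat.cast_sub (by omega), Nat.cast_one] at h2 h5
  rw [edgeHit]
  linarith

theorem abs_edgeHit_sub_le (hd : 2 ≤ d) (hp0 : 0 ≤ p) (hp1 : p ≤ 1) {x : ℝ} (h0 : 0 ≤ x)
    (h1 : x ≤ 1) : |edgeHit d p x - (d - p) * x| ≤ d ^ 2 * x ^ 2 := by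
  have h2 := edgeHit_le hd hp0 hp1 h1
  have h3 := le_edgeHit hd hp0 hp1 h0 h1
  have h4 : 0 ≤ (d : ℝ) ^ 2 * x ^ 2 := by positivity
  rw [abs_le]
  constructor <;> linarith

/-- By `sum_mul_hit_le` the first-order effect of the drawn vertices is nonpositive. What remains is
the dilution by e, which is 1 when a new vertex arrives and 0 otherwise. -/
theorem drawsE_collision_bound (hH : IsAt d t H) (k : ℕ) (e B : ℝ) :
    drawsE H.weight k (fun s => H.collision - 2 * (s.toFinset.card + e) * H.collision /
      H.totalDegree + 2 * (H.memberDegree s / H.totalDegree) / H.totalDegree + B) ≤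
      H.collision - 2 * e * H.collision / H.totalDegree + B := by
  have hS := hH.totalDegree_pos
  have e1 : (fun s : Multiset (Fin H.n) => H.collision - 2 * (s.toFinset.card + e) * H.collision /
      H.totalDegree + 2 * (H.memberDegree s / H.totalDegree) / H.totalDegree + B) =
      fun s => (H.collision - 2 * e * H.collision / H.totalDegree + B) +
        (2 / H.totalDegree) * ((H.totalDegree)⁻¹ * H.memberDegree s -
          H.collision * s.toFinset.card) := by
    ext s
    field_simp
    ring
  have e2 : drawsE H.weight k H.memberDegree =
      ∑ v : Fin H.n, (H.degree v : ℝ) * hit k (H.weight v) := drawsE_sum_mem hH.sum_weight k _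
  have e3 : (H.totalDegree)⁻¹ * drawsE H.weight k H.memberDegree =
      ∑ v : Fin H.n, H.weight v * hit k (H.weight v) := by
    rw [e2, Finset.mul_sum]
    refine Finset.sum_congr rfl fun v _ => ?_
    rw [weight]
    ring
  have h := sum_mul_hit_le H.weight_nonneg hH.sum_weight k
  rw [← e3] at h
  rw [e1, apply_add_fun _ (fun _ => _), drawsE_const hH.sum_weight, apply_const_mul, apply_sub_fun,
    apply_const_mul, apply_const_mul, drawsE_card_toFinset hH.sum_weight]
  have h2 : 0 ≤ 2 / H.totalDegree := by positivity
  have h3 : (H.totalDegree)⁻¹ * drawsE H.weight k H.memberDegree -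
      H.collision * ∑ v, hit k (H.weight v) ≤ 0 := by
    rw [collision]
    linarith
  linarith [mul_nonpos_of_nonneg_of_nonpos h2 h3]

theorem degSum_sq_le (hH : IsAt d t H) :
    H.degSum (fun k => (k : ℝ) ^ 2) ≤ H.totalDegree ^ 2 := by
  have h := H.collision_le_one
  have hS := hH.totalDegree_pos
  rwa [collision_eq, div_le_one (by positivity)] at h

theorem collision_addEdge_le (hd : 2 ≤ d) (hH : IsAt d t H) {s : Multiset (Fin H.n)}
    (hs : s.card = d) : (H.addEdge s).collision ≤
      H.collision - 2 * (s.toFinset.card + 0) * H.collision / H.totalDegree +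
        2 * (H.memberDegree s / H.totalDegree) / H.totalDegree +
        13 * (d : ℝ) ^ 3 / H.totalDegree ^ 2 := by
  rw [collision_eq, totalDegree_addEdge, degSum_addEdge, gain_sq, ← add_assoc, collision_eq,
    add_zero]
  refine add_div_sq_le hH.one_le_totalDegree (Finset.sum_nonneg fun _ _ => sq_nonneg _)
    (degSum_sq_le hH) (H.memberDegree_nonneg s) (H.memberDegree_le s) (Nat.cast_nonneg _) ?_ ?_
  · exact_mod_cast s.toFinset_card_le.trans hs.le
  · exact_mod_cast (by omega : 1 ≤ d)

theorem collision_addVertexEdge_le (hd : 2 ≤ d) (hH : IsAt d t H) {s : Multiset (Fin H.n)}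
    (hs : s.card = d - 1) : (H.addVertexEdge s).collision ≤
      H.collision - 2 * (s.toFinset.card + 1) * H.collision / H.totalDegree +
        2 * (H.memberDegree s / H.totalDegree) / H.totalDegree +
        13 * (d : ℝ) ^ 3 / H.totalDegree ^ 2 := by
  have h1 : H.degSum (fun k => (k : ℝ) ^ 2) + (2 * H.memberDegree s + s.toFinset.card) +
      ((1 : ℕ) : ℝ) ^ 2 =
      H.degSum (fun k => (k : ℝ) ^ 2) + 2 * H.memberDegree s + (s.toFinset.card + 1) := by
    push_cast
    ring
  rw [collision_eq, totalDegree_addVertexEdge, degSum_addVertexEdge, gain_sq, h1, collision_eq,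
    add_assoc H.totalDegree]
  refine add_div_sq_le hH.one_le_totalDegree (Finset.sum_nonneg fun _ _ => sq_nonneg _)
    (degSum_sq_le hH) (H.memberDegree_nonneg s) (H.memberDegree_le s) (by positivity) ?_ ?_
  · have := s.toFinset_card_le
    exact_mod_cast (by omega : s.toFinset.card + 1 ≤ d)
  · exact_mod_cast (by omega : 1 ≤ d)

theorem stepE_collision_le (hd : 2 ≤ d) (hp0 : 0 ≤ p) (hp1 : p ≤ 1) (hH : IsAt d t H) :
    stepE d p H collision ≤ (1 - 2 * p / d / ((t : ℝ) + 2)) * H.collision +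
      (13 * (d : ℝ) ^ 3 * ((t : ℝ) + 2) / ((t : ℝ) + 1) ^ 2) / ((t : ℝ) + 2) := by
  have h1 := (drawsE_mono H.weight_nonneg fun s hs => collision_addVertexEdge_le hd hH hs).trans
    (drawsE_collision_bound hH (d - 1) 1 _)
  have h2 := (drawsE_mono H.weight_nonneg fun s hs => collision_addEdge_le hd hH hs).trans
    (drawsE_collision_bound hH d 0 _)
  have h3 := mul_le_mul_of_nonneg_left h1 hp0
  have h4 := mul_le_mul_of_nonneg_left h2 (sub_nonneg.2 hp1)
  have hS := hH.totalDegree_pos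
  have hd0 : (0 : ℝ) < d := by exact_mod_cast (by omega : 0 < d)
  have h5 : 13 * (d : ℝ) ^ 3 / H.totalDegree ^ 2 ≤ 13 * (d : ℝ) ^ 3 / ((t : ℝ) + 1) ^ 2 := by
    gcongr
    exact hH.le_totalDegree
  -- The total degree is at most d(t+1); enlarging this to d(t+2) gives the denominator of
  -- `tendsto_zero_of_recursive_le`.
  have h6 : 2 * p / d / ((t : ℝ) + 2) * H.collision ≤ 2 * p / H.totalDegree * H.collision := by
    have := H.collision_nonneg
    rw [div_div]
    gcongr
    refine hH.totalDegree_le.trans ?_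
    gcongr
    norm_num
  have h7 : (13 * (d : ℝ) ^ 3 * ((t : ℝ) + 2) / ((t : ℝ) + 1) ^ 2) / ((t : ℝ) + 2) =
      13 * (d : ℝ) ^ 3 / ((t : ℝ) + 1) ^ 2 := by
    field_simp
  have h8 : 2 * p / H.totalDegree * H.collision = p * (2 * 1 * H.collision / H.totalDegree) := by
    ring
  rw [stepE_apply, h7]
  simp only [mul_zero, zero_mul, zero_div, sub_zero] at h4
  linarith

/-- By how much the sum of the degrees stays behind its largest possible value. -/
def deficit (d t : ℕ) (H : MultiHypergraph) : ℝ := d * ((t : ℝ) + 1) - H.totalDegree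

theorem deficit_nonneg (hH : IsAt d t H) : 0 ≤ deficit d t H := sub_nonneg.2 hH.totalDegree_le

/-- The expected number of repetitions in a new hyperedge. -/
noncomputable def repetition (d : ℕ) (p : ℝ) (H : MultiHypergraph) : ℝ :=
  p * drawsE H.weight (d - 1) (fun s => ((d - 1 : ℕ) : ℝ) - s.toFinset.card) +
    (1 - p) * drawsE H.weight d (fun s => (d : ℝ) - s.toFinset.card)

theorem repetition_le (hp0 : 0 ≤ p) (hp1 : p ≤ 1) (hH : IsAt d t H) :
    repetition d p H ≤ d ^ 2 * H.collision := by
  have h1 := mul_le_mul_of_nonneg_left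
    (drawsE_sub_card_toFinset_le H.weight_nonneg hH.sum_weight (d - 1)) hp0
  have h2 := mul_le_mul_of_nonneg_left
    (drawsE_sub_card_toFinset_le H.weight_nonneg hH.sum_weight d) (sub_nonneg.2 hp1)
  have h4 : (((d - 1 : ℕ) : ℝ)) ^ 2 * H.collision ≤ d ^ 2 * H.collision := by
    have := H.collision_nonneg
    gcongr
    exact Nat.sub_le d 1
  have h5 := mul_le_mul_of_nonneg_left h4 hp0
  rw [repetition]
  rw [← collision] at h1 h2
  linarith

theorem stepE_deficit_le (hd : 2 ≤ d) (hp0 : 0 ≤ p) (hp1 : p ≤ 1) (hH : IsAt d t H) :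
    stepE d p H (deficit d (t + 1)) ≤ deficit d t H + d ^ 2 * H.collision := by
  refine le_trans (le_of_eq ?_) (add_le_add_right (repetition_le hp0 hp1 hH) _)
  have e1 : ∀ s, deficit d (t + 1) (H.addVertexEdge s) =
      deficit d t H + (((d - 1 : ℕ) : ℝ) - s.toFinset.card) := fun s => by
    rw [deficit, deficit, totalDegree_addVertexEdge, Nat.cast_sub (by omega)]
    push_cast
    ring
  have e2 : ∀ s, deficit d (t + 1) (H.addEdge s) =
      deficit d t H + ((d : ℝ) - s.toFinset.card) := fun s => by
    rw [deficit, deficit, totalDegree_addEdge]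
    push_cast
    ring
  rw [stepE_apply]
  simp_rw [e1, e2]
  rw [apply_add_fun _ (fun _ => _), apply_add_fun _ (fun _ => _), drawsE_const hH.sum_weight,
    drawsE_const hH.sum_weight, repetition]
  ring

end Step

section Limits

variable {d : ℕ} (hd : 2 ≤ d) {p : ℝ}
include hd

theorem tendsto_lawE_collision (hp0 : 0 < p) (hp1 : p ≤ 1) :
    Tendsto (fun t => lawE d hd p t collision) atTop (𝓝 0) := by
  have hd0 : (0 : ℝ) < d := by exact_mod_cast (by omega : 0 < d)
  refine tendsto_zero_of_recursive_le (b := 2 * p / d)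
    (ε := fun t => 13 * (d : ℝ) ^ 3 * ((t : ℝ) + 2) / ((t : ℝ) + 1) ^ 2) (by positivity)
    (fun t => lawE_nonneg hd hp0.le hp1 fun H _ => H.collision_nonneg)
    (Eventually.of_forall fun t => ?_) ?_
  · rw [lawE_succ]
    refine (lawE_mono hd hp0.le hp1 fun H hH => stepE_collision_le hd hp0.le hp1 hH).trans_eq ?_
    rw [apply_add_fun _ _ (fun _ => _), apply_const_mul, lawE_const hd hp0.le hp1]
  · have h1 : Tendsto (fun t : ℕ => 1 / ((t : ℝ) + 1)) atTop (𝓝 0) :=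
      tendsto_one_div_add_atTop_nhds_zero_nat
    have h2 := ((h1.add (h1.mul h1)).const_mul (13 * (d : ℝ) ^ 3))
    simp only [mul_zero, add_zero] at h2
    refine h2.congr fun t => ?_
    field_simp
    ring

theorem tendsto_lawE_deficit (hp0 : 0 < p) (hp1 : p ≤ 1) :
    Tendsto (fun t : ℕ => lawE d hd p t (deficit d t) / ((t : ℝ) + 1)) atTop (𝓝 0) := by
  refine tendsto_div_zero_of_increment_le
    (c := fun t => d ^ 2 * lawE d hd p t collision)
    (fun t => lawE_nonneg hd hp0.le hp1 fun H hH => deficit_nonneg hH) (fun t => ?_) ?_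
  · rw [lawE_succ]
    refine (lawE_mono hd hp0.le hp1 fun H hH => stepE_deficit_le hd hp0.le hp1 hH).trans_eq ?_
    rw [apply_add_fun, apply_const_mul]
  · simpa using (tendsto_lawE_collision hd hp0 hp1).const_mul ((d : ℝ) ^ 2)

end Limits

/-! ### Limits of the degree counts in the hypergraph -/

/-- The number of vertices of degree `k`. -/
def degCount (k : ℕ) (H : MultiHypergraph) : ℝ := H.degSum fun i => if i = k then 1 else 0

theorem numDegree_eq (H : MultiHypergraph) (k : ℕ) : (H.numDegree k : ℝ) = degCount k H := by
  simp [numDegree, degCount, degSum]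

section Count

variable {d t : ℕ} {p : ℝ} {H : MultiHypergraph}

theorem degCount_eq (k : ℕ) (H : MultiHypergraph) :
    degCount k H = ∑ v : Fin H.n, if H.degree v = k then 1 else 0 := rfl

theorem degCount_nonneg (k : ℕ) (H : MultiHypergraph) : 0 ≤ degCount k H := by
  rw [degCount_eq]
  positivity

theorem degCount_le (hH : IsAt d t H) (k : ℕ) : degCount k H ≤ (t : ℝ) + 1 := by
  have h : degCount k H ≤ ∑ v : Fin H.n, 1 := by
    rw [degCount_eq]
    exact Finset.sum_le_sum fun _ _ => by split_ifs <;> simp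
  have h2 : (H.n : ℝ) ≤ (t : ℝ) + 1 := by exact_mod_cast hH.n_le
  simp at h
  linarith

theorem sum_ite_mul_edgeHit (k : ℕ) :
    ∑ v : Fin H.n, (if H.degree v = k then 1 else 0) * edgeHit d p (H.weight v) =
      degCount k H * edgeHit d p (k / H.totalDegree) := by
  rw [degCount, degSum, Finset.sum_mul]
  refine Finset.sum_congr rfl fun v _ => ?_
  split_ifs with h
  · rw [weight, h]
  · simp

/-- The error of the linear approximation of the flow out of degree `k`. -/
noncomputable def flowError (d : ℕ) (p : ℝ) (t k : ℕ) (H : MultiHypergraph) : ℝ :=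
  degCount k H * edgeHit d p (k / H.totalDegree) -
    (d - p) / d * k / ((t : ℝ) + 1) * degCount k H

theorem abs_flowError_le (hd : 2 ≤ d) (hp0 : 0 ≤ p) (hp1 : p ≤ 1) (hH : IsAt d t H) (k : ℕ) :
    |flowError d p t k H| ≤ d ^ 2 * k ^ 2 / ((t : ℝ) + 1) +
      k * (deficit d t H / ((t : ℝ) + 1)) := by
  have hd0 : (0 : ℝ) < d := by exact_mod_cast (by omega : 0 < d)
  have hpd : 0 ≤ (d - p) / d := by
    have : (2 : ℝ) ≤ d := by exact_mod_cast hd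
    exact div_nonneg (by linarith) hd0.le
  have hpd1 : (d - p) / d ≤ 1 := by
    rw [div_le_one hd0]
    linarith
  have ht : (0 : ℝ) < (t : ℝ) + 1 := by positivity
  have hS := hH.totalDegree_pos
  have hdef := deficit_nonneg hH
  -- If no vertex has degree k, then k/S may exceed 1 and the estimate of `edgeHit` is not
  -- available, but the error vanishes.
  by_cases hex : ∃ v : Fin H.n, H.degree v = k
  · obtain ⟨v, hv⟩ := hex
    have h0 : 0 ≤ (k : ℝ) / H.totalDegree := by positivity
    have h1 : (k : ℝ) / H.totalDegree ≤ 1 := by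
      have := hH.weight_le_one v
      rwa [weight, hv] at this
    -- Two sources of error: linearizing the hitting probability, and replacing S by d(t+1).
    have e : flowError d p t k H =
        degCount k H * (edgeHit d p (k / H.totalDegree) - (d - p) * (k / H.totalDegree)) +
          degCount k H * ((d - p) / d * k * (deficit d t H / (H.totalDegree * ((t : ℝ) + 1)))) := by
      rw [flowError, deficit]
      field_simp
      ring
    have hm := degCount_nonneg k H
    have hmS : degCount k H ≤ H.totalDegree := (degCount_le hH k).trans hH.le_totalDegree
    rw [e]
    refine (abs_add_le _ _).trans (add_le_add ?_ ?_)
    · rw [abs_mul, abs_of_nonneg hm]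
      calc degCount k H * _ ≤ H.totalDegree * (d ^ 2 * (k / H.totalDegree) ^ 2) := by
            gcongr
            exact abs_edgeHit_sub_le hd hp0 hp1 h0 h1
        _ = d ^ 2 * k ^ 2 / H.totalDegree := by field_simp
        _ ≤ _ := by
            gcongr
            exact hH.le_totalDegree
    · rw [abs_of_nonneg (by positivity)]
      calc _ ≤ H.totalDegree *
            (1 * k * (deficit d t H / (H.totalDegree * ((t : ℝ) + 1)))) := by gcongr
        _ = _ := by field_simp
  · have h0 : degCount k H = 0 := by
      rw [degCount_eq]
      exact Finset.sum_eq_zero fun v _ => if_neg fun h => hex ⟨v, h⟩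
    rw [flowError, h0]
    simp only [zero_mul, mul_zero, sub_zero, abs_zero]
    positivity

theorem stepE_degCount_succ (hH : IsAt d t H) (k : ℕ) :
    stepE d p H (degCount (k + 1)) =
      (1 - (d - p) / d * ((k + 1 : ℕ) : ℝ) / ((t : ℝ) + 1)) * degCount (k + 1) H +
      ((d - p) / d * k / ((t : ℝ) + 1) * degCount k H + (if k = 0 then p else 0)) +
      (flowError d p t k H - flowError d p t (k + 1) H) := by
  have e : ∀ v : Fin H.n, ((if H.degree v + 1 = k + 1 then (1 : ℝ) else 0) -
      if H.degree v = k + 1 then 1 else 0) * edgeHit d p (H.weight v) =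
      (if H.degree v = k then 1 else 0) * edgeHit d p (H.weight v) -
        (if H.degree v = k + 1 then 1 else 0) * edgeHit d p (H.weight v) := fun v => by
    rw [sub_mul]
    simp only [Nat.add_right_cancel_iff]
  have e2 : p * (if 1 = k + 1 then (1 : ℝ) else 0) = if k = 0 then p else 0 := by
    by_cases hk : k = 0 <;> simp [hk]
  have e3 := stepE_degSum (p := p) hH fun i => if i = k + 1 then 1 else 0
  simp only [e, e2, Finset.sum_sub_distrib, sum_ite_mul_edgeHit] at e3
  refine e3.trans ?_
  rw [flowError, flowError, ← degCount]
  ring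

theorem stepE_degCount_zero (hH : IsAt d t H) : stepE d p H (degCount 0) = degCount 0 H := by
  have e3 := stepE_degSum (p := p) hH fun i => if i = 0 then 1 else 0
  have e : ∀ v : Fin H.n, ((if H.degree v + 1 = 0 then (1 : ℝ) else 0) -
      if H.degree v = 0 then 1 else 0) * edgeHit d p (H.weight v) =
      - ((if H.degree v = 0 then 1 else 0) * edgeHit d p (H.weight v)) := fun v => by
    simp
  simp only [e, Finset.sum_neg_distrib, sum_ite_mul_edgeHit] at e3
  refine e3.trans ?_
  rw [← degCount]
  simp [edgeHit, hit]

end Count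

section Limits

variable {d : ℕ} (hd : 2 ≤ d) {p : ℝ} (hp0 : 0 < p) (hp1 : p ≤ 1)
include hd hp0 hp1

theorem tendsto_lawE_flowError (k : ℕ) :
    Tendsto (fun t : ℕ => lawE d hd p t (flowError d p t k)) atTop (𝓝 0) := by
  rw [tendsto_zero_iff_abs_tendsto_zero]
  have h1 : Tendsto (fun t : ℕ => 1 / ((t : ℝ) + 1)) atTop (𝓝 0) :=
    tendsto_one_div_add_atTop_nhds_zero_nat
  have h2 := (h1.const_mul ((d : ℝ) ^ 2 * k ^ 2)).add
    ((tendsto_lawE_deficit hd hp0 hp1).const_mul (k : ℝ))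
  simp only [mul_zero, add_zero] at h2
  refine squeeze_zero (fun _ => abs_nonneg _) (fun t => ?_) h2
  refine (abs_lawE_le hd hp0.le hp1 fun H hH =>
    abs_flowError_le hd hp0.le hp1 hH k).trans_eq ?_
  simp_rw [div_eq_inv_mul (deficit d t _)]
  rw [apply_add_fun _ (fun _ => _), lawE_const hd hp0.le hp1, apply_const_mul, apply_const_mul]
  ring

/-- Induction on k: the limit for degree k gives a convergent inflow into degree k+1, and
`tendsto_div_of_recursion` with b = α(k+1) reproduces the recursion that defines `freq`. -/
theorem tendsto_lawE_degCount (k : ℕ) :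
    Tendsto (fun t : ℕ => lawE d hd p t (degCount k) / ((t : ℝ) + 1)) atTop
      (𝓝 (freq ((d - p) / d) p k)) := by
  have hd2 : (2 : ℝ) ≤ d := by exact_mod_cast hd
  have hα : 0 ≤ (d - p) / d := div_nonneg (by linarith) (by linarith)
  induction k with
  | zero =>
    have h : ∀ t : ℕ, lawE d hd p t (degCount 0) = lawE d hd p 0 (degCount 0) := by
      intro t
      induction t with
      | zero => rfl
      | succ t ih =>
        rw [lawE_succ, lawE_congr hd hp0.le hp1 fun H hH => stepE_degCount_zero hH]
        exact ih
    simp_rw [h]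
    have h1 : Tendsto (fun t : ℕ => 1 / ((t : ℝ) + 1)) atTop (𝓝 0) :=
      tendsto_one_div_add_atTop_nhds_zero_nat
    simpa [freq, div_eq_mul_inv] using h1.const_mul (lawE d hd p 0 (degCount 0))
  | succ k ih =>
    have h := tendsto_div_of_recursion (a := fun t => lawE d hd p t (degCount (k + 1)))
      (b := (d - p) / d * ((k + 1 : ℕ) : ℝ))
      (c := fun t => ((d - p) / d * k * (lawE d hd p t (degCount k) / ((t : ℝ) + 1)) +
        (if k = 0 then p else 0)) + (lawE d hd p t (flowError d p t k) -
          lawE d hd p t (flowError d p t (k + 1)))) (by positivity) (fun t => ?_)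
      (((ih.const_mul _).add_const _).add ((tendsto_lawE_flowError hd hp0 hp1 k).sub
        (tendsto_lawE_flowError hd hp0 hp1 (k + 1))))
    · simpa [freq] using h
    · rw [lawE_succ, lawE_congr hd hp0.le hp1 fun H hH => stepE_degCount_succ hH k,
        apply_add_fun _ (fun _ => _), apply_add_fun _ (fun _ => _), apply_const_mul,
        apply_add_fun _ (fun _ => _) (fun _ => _), apply_const_mul, lawE_const hd hp0.le hp1,
        apply_sub_fun]
      ring

end Limits

/-! ### Neighbours in the observed graph and defective vertices -/

/-- The vertices that share a hyperedge of `E` with `v`. -/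
def coMembers (E : Multiset (Multiset ℕ)) (v : ℕ) : Finset ℕ :=
  (E.filter (v ∈ ·)).join.toFinset.erase v

theorem mem_coMembers {E : Multiset (Multiset ℕ)} {v u : ℕ} :
    u ∈ coMembers E v ↔ u ≠ v ∧ ∃ e ∈ E, v ∈ e ∧ u ∈ e := by
  simp [coMembers, Multiset.mem_join, and_assoc]

theorem coMembers_cons_of_mem {E : Multiset (Multiset ℕ)} {e : Multiset ℕ} {v : ℕ} (h : v ∈ e) :
    coMembers (e ::ₘ E) v = e.toFinset.erase v ∪ coMembers E v := by
  ext u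
  simp only [mem_coMembers, Finset.mem_union, Finset.mem_erase, Multiset.mem_toFinset,
    Multiset.mem_cons, or_and_right, exists_or, exists_eq_left]
  tauto

theorem coMembers_cons_of_notMem {E : Multiset (Multiset ℕ)} {e : Multiset ℕ} {v : ℕ}
    (h : v ∉ e) : coMembers (e ::ₘ E) v = coMembers E v := by
  ext u
  simp only [mem_coMembers, Multiset.mem_cons, or_and_right, exists_or, exists_eq_left]
  tauto

theorem card_coMembers_le {d : ℕ} (E : Multiset (Multiset ℕ)) (v : ℕ)
    (h : ∀ e ∈ E, e.card = d) : (coMembers E v).card ≤ (d - 1) * E.countP (v ∈ ·) := by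
  induction E using Multiset.induction with
  | empty => simp [coMembers]
  | cons e E ih =>
    have ih := ih fun e' he' => h e' (Multiset.mem_cons_of_mem he')
    by_cases hv : v ∈ e
    · rw [coMembers_cons_of_mem hv, Multiset.countP_cons_of_pos (p := (v ∈ ·)) _ hv, mul_add,
        mul_one]
      refine (Finset.card_union_le _ _).trans ?_
      have h1 : (e.toFinset.erase v).card ≤ d - 1 := by
        rw [Finset.card_erase_of_mem (Multiset.mem_toFinset.2 hv)]
        have := e.toFinset_card_le
        have := h e (Multiset.mem_cons_self _ _)
        omega
      omega
    · rwa [coMembers_cons_of_notMem hv, Multiset.countP_cons_of_neg (p := (v ∈ ·)) _ hv]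

/-- The vertex `v` has at most `j` neighbours, and less than its degree makes possible. -/
def Defective (d j : ℕ) (E : Multiset (Multiset ℕ)) (v : ℕ) : Prop :=
  (coMembers E v).card ≤ j ∧ (coMembers E v).card < (d - 1) * E.countP (v ∈ ·)

/-- If e has no repetition and avoids the old neighbours of v, it brings v exactly d-1 new ones and
leaves the shortfall unchanged. Neighbour sets only grow, so the bound j also held before. -/
theorem Defective.of_cons {d j : ℕ} {E : Multiset (Multiset ℕ)} {e : Multiset ℕ} {v : ℕ}
    (he : e.card = d) (h : Defective d j (e ::ₘ E) v) :
    Defective d j E v ∨ v ∈ e ∧ (¬ e.Nodup ∨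
      (coMembers E v).card ≤ j ∧ ∃ u ∈ e, u ∈ coMembers E v) := by
  by_cases hv : v ∈ e
  · by_cases hn : e.Nodup
    · rw [Defective, coMembers_cons_of_mem hv,
        Multiset.countP_cons_of_pos (p := (v ∈ ·)) _ hv] at h
      have hj : (coMembers E v).card ≤ j :=
        (Finset.card_le_card Finset.subset_union_right).trans h.1
      by_cases hu : ∃ u ∈ e, u ∈ coMembers E v
      · exact Or.inr ⟨hv, Or.inr ⟨hj, hu⟩⟩
      · refine Or.inl ⟨hj, ?_⟩
        have h2 := h.2
        rw [Finset.card_union_of_disjoint, Finset.card_erase_of_mem (Multiset.mem_toFinset.2 hv),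
          Multiset.toFinset_card_of_nodup hn, he, mul_add, mul_one] at h2
        · omega
        · rw [Finset.disjoint_left]
          intro u h1 h3
          exact hu ⟨u, Multiset.mem_toFinset.1 (Finset.mem_of_mem_erase h1), h3⟩
    · exact Or.inr ⟨hv, Or.inl hn⟩
  · left
    rwa [Defective, coMembers_cons_of_notMem hv,
      Multiset.countP_cons_of_neg (p := (v ∈ ·)) _ hv] at h

namespace MultiHypergraph

variable (H : MultiHypergraph)

theorem degree_observedGraph (v : Fin H.n) [Fintype (H.observedGraph.neighborSet v)] :
    H.observedGraph.degree v = (coMembers H.edges v).card := by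
  rw [← SimpleGraph.card_neighborFinset_eq_degree, ← Finset.card_map Fin.valEmbedding]
  congr 1
  ext u
  simp only [Finset.mem_map, SimpleGraph.mem_neighborFinset, mem_coMembers,
    Fin.valEmbedding_apply]
  constructor
  · rintro ⟨u, ⟨h1, e, he, h⟩, rfl⟩
    exact ⟨fun h => h1 (Fin.ext h.symm), e, he, h⟩
  · rintro ⟨h1, e, he, h⟩
    exact ⟨⟨u, H.incidence e he u h.2⟩, ⟨fun h => h1 (by rw [h]), e, he, h⟩, rfl⟩

theorem coMembers_lt {v u : ℕ} (h : u ∈ coMembers H.edges v) : u < H.n := by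
  obtain ⟨-, e, he, -, hu⟩ := mem_coMembers.1 h
  exact H.incidence e he u hu

open Classical in
theorem numObservedDegree_eq (j : ℕ) : (H.numObservedDegree j : ℝ) =
    ∑ v : Fin H.n, if (coMembers H.edges v).card = j then 1 else 0 := by
  rw [numObservedDegree]
  simp only [degree_observedGraph]
  simp

end MultiHypergraph

open Classical in
/-- The number of defective vertices. -/
noncomputable def defectCount (d j : ℕ) (H : MultiHypergraph) : ℝ :=
  ∑ v : Fin H.n, if Defective d j H.edges v then 1 else 0

theorem defectCount_nonneg (d j : ℕ) (H : MultiHypergraph) : 0 ≤ defectCount d j H :=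
  Finset.sum_nonneg fun _ _ => by split_ifs <;> simp

open Classical in
/-- The indicator of two vertices being adjacent, the first of them of degree at most `j`. -/
noncomputable def lowAdj (j : ℕ) (H : MultiHypergraph) (v u : Fin H.n) : ℝ :=
  if (coMembers H.edges v).card ≤ j ∧ (u : ℕ) ∈ coMembers H.edges v then 1 else 0

/-- The number of adjacent pairs in `s` with first vertex of degree at most `j`. -/
noncomputable def adjacentPairs (j : ℕ) (H : MultiHypergraph) (s : Multiset (Fin H.n)) : ℝ :=
  ∑ v, ∑ u, lowAdj j H v u * if v ∈ s ∧ u ∈ s then 1 else 0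

section Defect

variable {d j t : ℕ} {p : ℝ} {H : MultiHypergraph}

theorem lowAdj_nonneg (v u : Fin H.n) : 0 ≤ lowAdj j H v u := by
  rw [lowAdj]
  split_ifs <;> simp

theorem sum_lowAdj_le (v : Fin H.n) : ∑ u, lowAdj j H v u ≤ j := by
  classical
  by_cases h : (coMembers H.edges v).card ≤ j
  · have h1 : ∑ u, lowAdj j H v u =
        ((Finset.univ.filter fun u : Fin H.n => (u : ℕ) ∈ coMembers H.edges v).card : ℝ) := by
      simp [lowAdj, h]
    rw [h1]
    refine le_trans ?_ (Nat.cast_le.2 h)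
    rw [← Finset.card_map Fin.valEmbedding]
    refine Nat.cast_le.2 (Finset.card_le_card fun u hu => ?_)
    obtain ⟨w, hw, rfl⟩ := Finset.mem_map.1 hu
    exact (Finset.mem_filter.1 hw).2
  · simp [lowAdj, h]

/-- A form of w ≤ √Y that is linear in Y, so that its expectation involves only E Y. -/
theorem weight_le_of_pos {ε : ℝ} (hε : 0 < ε) (u : Fin H.n) :
    H.weight u ≤ ε + H.collision / ε := by
  have h1 : H.weight u ^ 2 ≤ H.collision :=
    Finset.single_le_sum (f := fun v => H.weight v ^ 2) (fun v _ => sq_nonneg _)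
      (Finset.mem_univ u)
  have h2 := H.weight_nonneg u
  have h3 : H.weight u * ε ≤ ε * ε + H.collision := by nlinarith [sq_nonneg (H.weight u - ε)]
  rw [show ε + H.collision / ε = (ε * ε + H.collision) / ε by field_simp, le_div_iff₀ hε]
  exact h3

/-- A pair v, u is drawn with probability at most d²w(v)w(u). Each v has at most j relevant partners
u, every w(u) is small, and the w(v) sum to 1. This is where the cutoff j is needed. -/
theorem drawsE_adjacentPairs_le (hH : IsAt d t H) {ε : ℝ} (hε : 0 < ε) {k : ℕ} (hk : k ≤ d) :
    drawsE H.weight k (adjacentPairs j H) ≤ d ^ 2 * (j * (ε + H.collision / ε)) := by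
  have hY := H.collision_nonneg
  have hw := H.weight_nonneg
  have e : drawsE H.weight k (adjacentPairs j H) = ∑ v, ∑ u, lowAdj j H v u *
      drawsE H.weight k (fun s => if v ∈ s ∧ u ∈ s then 1 else 0) := by
    rw [show adjacentPairs j H = fun s => ∑ v, ∑ u, lowAdj j H v u * if v ∈ s ∧ u ∈ s then 1 else 0
      from rfl, apply_sum_fun]
    refine Finset.sum_congr rfl fun v _ => ?_
    rw [apply_sum_fun]
    exact Finset.sum_congr rfl fun u _ => apply_const_mul _ _ _
  have h1 : ∀ v u, lowAdj j H v u *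
      drawsE H.weight k (fun s => if v ∈ s ∧ u ∈ s then 1 else 0) ≤
      d ^ 2 * (H.weight v * ((ε + H.collision / ε) * lowAdj j H v u)) := by
    intro v u
    by_cases hvu : v = u
    · have : lowAdj j H v u = 0 := by
        rw [lowAdj, if_neg]
        rintro ⟨-, h⟩
        exact (mem_coMembers.1 h).1 (by rw [hvu])
      simp [this]
    · calc _ ≤ lowAdj j H v u * (k ^ 2 * (H.weight v * H.weight u)) :=
            mul_le_mul_of_nonneg_left (drawsE_mem_and_mem_le hw hH.sum_weight k hvu)
              (lowAdj_nonneg v u)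
        _ ≤ lowAdj j H v u * (d ^ 2 * (H.weight v * (ε + H.collision / ε))) := by
            have := lowAdj_nonneg (j := j) v u
            have := hw v
            have := hw u
            gcongr
            exact weight_le_of_pos hε u
        _ = _ := by ring
  rw [e]
  calc _ ≤ ∑ v, ∑ u, d ^ 2 * (H.weight v * ((ε + H.collision / ε) * lowAdj j H v u)) :=
        Finset.sum_le_sum fun v _ => Finset.sum_le_sum fun u _ => h1 v u
    _ = ∑ v, d ^ 2 * (H.weight v * ((ε + H.collision / ε) * ∑ u, lowAdj j H v u)) := by
        simp_rw [Finset.mul_sum]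
    _ ≤ ∑ v, d ^ 2 * (H.weight v * ((ε + H.collision / ε) * j)) := by
        refine Finset.sum_le_sum fun v _ => ?_
        have := hw v
        gcongr
        exact sum_lowAdj_le v
    _ = d ^ 2 * (j * (ε + H.collision / ε)) := by
        rw [← Finset.mul_sum, ← Finset.sum_mul, hH.sum_weight]
        ring

theorem one_le_sub_card_toFinset {α : Type*} [DecidableEq α] {s : Multiset α} {k : ℕ}
    (hs : s.card = k) (h : ¬ s.Nodup) : (1 : ℝ) ≤ k - s.toFinset.card := by
  have h1 := Multiset.toFinset_card_eq_card_iff_nodup.not.2 h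
  have h2 := s.toFinset_card_le
  have h3 : s.toFinset.card + 1 ≤ k := by omega
  have h4 : (s.toFinset.card : ℝ) + 1 ≤ k := by exact_mod_cast h3
  linarith

theorem sub_card_toFinset_nonneg {α : Type*} [DecidableEq α] {s : Multiset α} {k : ℕ}
    (hs : s.card = k) : (0 : ℝ) ≤ k - s.toFinset.card := by
  rw [sub_nonneg, ← hs]
  exact_mod_cast s.toFinset_card_le

-- One formulation for both kinds of step: e is the new hyperedge, s its drawn part. A repetition
-- spoils at most k members, and k - |s.toFinset| is at least 1 when one occurs; every other new
-- defect is witnessed by an adjacent pair in s.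
open Classical in
theorem sum_defective_cons_le {k : ℕ} {s : Multiset (Fin H.n)} {e : Multiset ℕ}
    (he : e.card = d) (hs : s.card = k) (hes : ∀ v : Fin H.n, (v : ℕ) ∈ e ↔ v ∈ s)
    (hn : s.Nodup → e.Nodup) :
    ∑ v : Fin H.n, (if Defective d j (e ::ₘ H.edges) v then (1 : ℝ) else 0) ≤
      defectCount d j H + k * (k - s.toFinset.card) + adjacentPairs j H s := by
  have hk := sub_card_toFinset_nonneg hs
  have h1 : ∀ v : Fin H.n, (if Defective d j (e ::ₘ H.edges) v then (1 : ℝ) else 0) ≤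
      (if Defective d j H.edges v then 1 else 0) +
        (if v ∈ s then 1 else 0) * (k - s.toFinset.card) +
        ∑ u, lowAdj j H v u * if v ∈ s ∧ u ∈ s then 1 else 0 := by
    intro v
    have p1 : (0 : ℝ) ≤ if Defective d j H.edges v then 1 else 0 := by split_ifs <;> simp
    have p2 : (0 : ℝ) ≤ (if v ∈ s then 1 else 0) * (k - s.toFinset.card) := by
      split_ifs <;> simp [hk]
    have p3 : ∀ u, (0 : ℝ) ≤ lowAdj j H v u * if v ∈ s ∧ u ∈ s then 1 else 0 := fun u =>
      mul_nonneg (lowAdj_nonneg v u) (by split_ifs <;> simp)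
    have p4 := Finset.sum_nonneg fun u (_ : u ∈ Finset.univ) => p3 u
    by_cases h : Defective d j (e ::ₘ H.edges) v
    · rw [if_pos h]
      rcases h.of_cons he with h | ⟨hv, h | ⟨hj, u, hu, huv⟩⟩
      · rw [if_pos h] at p1 ⊢
        linarith
      · have hv' := (hes v).1 hv
        have := one_le_sub_card_toFinset hs fun h' => h (hn h')
        rw [if_pos hv'] at p2 ⊢
        linarith
      · have hv' := (hes v).1 hv
        have hu' := (hes ⟨u, H.coMembers_lt huv⟩).1 hu
        have := Finset.single_le_sum (fun u _ => p3 u) (Finset.mem_univ ⟨u, H.coMembers_lt huv⟩)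
        rw [if_pos ⟨hv', hu'⟩, lowAdj, if_pos ⟨hj, huv⟩] at this
        linarith
    · rw [if_neg h]
      linarith
  refine (Finset.sum_le_sum fun v _ => h1 v).trans ?_
  rw [Finset.sum_add_distrib, Finset.sum_add_distrib, ← Finset.sum_mul, ← card_toFinset_eq_sum,
    defectCount, adjacentPairs]
  have : (s.toFinset.card : ℝ) ≤ k := by linarith
  gcongr

theorem defectCount_addEdge_le {s : Multiset (Fin H.n)} (hs : s.card = d) :
    defectCount d j (H.addEdge s) ≤
      defectCount d j H + d * (d - s.toFinset.card) + adjacentPairs j H s := by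
  classical
  have h3 : defectCount d j (H.addEdge s) = ∑ v : Fin H.n,
      if Defective d j (s.map Fin.val ::ₘ H.edges) v then 1 else 0 := rfl
  rw [h3]
  exact sum_defective_cons_le (by rw [Multiset.card_map, hs]) hs (fun _ => H.mem_map_val)
    fun h => h.map Fin.val_injective

theorem defectCount_addVertexEdge_le (hd : 2 ≤ d) {s : Multiset (Fin H.n)}
    (hs : s.card = d - 1) : defectCount d j (H.addVertexEdge s) ≤
      defectCount d j H + d * ((d - 1 : ℕ) - s.toFinset.card) + adjacentPairs j H s := by
  classical
  have hmem : H.n ∉ s.map Fin.val := by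
    intro h
    obtain ⟨v, -, hv⟩ := Multiset.mem_map.1 h
    exact v.isLt.ne hv
  have hcard : (H.n ::ₘ s.map Fin.val).card = d := by
    rw [Multiset.card_cons, Multiset.card_map, hs]
    omega
  have hn : s.Nodup → (H.n ::ₘ s.map Fin.val).Nodup := fun h =>
    Multiset.nodup_cons.2 ⟨hmem, h.map Fin.val_injective⟩
  have h1 := sum_defective_cons_le (j := j) (H := H) (e := H.n ::ₘ s.map Fin.val) hcard hs
    (fun v => by rw [Multiset.mem_cons, H.mem_map_val, or_iff_right v.isLt.ne]) hn
  have h2 : (if Defective d j ((H.n ::ₘ s.map Fin.val) ::ₘ H.edges) H.n then (1 : ℝ) else 0) ≤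
      (d - 1 : ℕ) - s.toFinset.card := by
    split_ifs with h
    · refine one_le_sub_card_toFinset hs fun h' => ?_
      rcases h.of_cons hcard with h | ⟨-, h | ⟨-, u, -, hu⟩⟩
      · have h3 := h.2
        have h4 := H.degree_n
        rw [degree] at h4
        rw [h4] at h3
        omega
      · exact h (hn h')
      · obtain ⟨-, e, he, hv, -⟩ := mem_coMembers.1 hu
        exact (H.incidence e he _ hv).ne rfl
    · exact sub_card_toFinset_nonneg hs
  have h3 : defectCount d j (H.addVertexEdge s) = ∑ v : Fin (H.n + 1),
      if Defective d j ((H.n ::ₘ s.map Fin.val) ::ₘ H.edges) v then 1 else 0 := rfl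
  have h4 : (d : ℝ) = (d - 1 : ℕ) + 1 := by
    rw [Nat.cast_sub (by omega)]
    simp
  rw [h3, Fin.sum_univ_castSucc]
  simp only [Fin.val_castSucc, Fin.val_last]
  -- Of the d units, d-1 pay for the drawn vertices and one for the new vertex, which is defective
  -- only if the draw has a repetition.
  rw [h4, add_mul, one_mul]
  linarith

theorem stepE_defectCount_le (hd : 2 ≤ d) (hp0 : 0 ≤ p) (hp1 : p ≤ 1) (hH : IsAt d t H) {ε : ℝ}
    (hε : 0 < ε) : stepE d p H (defectCount d j) ≤ defectCount d j H +
      d * (d ^ 2 * H.collision) + d ^ 2 * (j * (ε + H.collision / ε)) := by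
  have e : ∀ (k : ℕ) (c : ℝ), drawsE H.weight k (fun s => defectCount d j H +
      d * (c - s.toFinset.card) + adjacentPairs j H s) = defectCount d j H +
        d * drawsE H.weight k (fun s => c - s.toFinset.card) +
        drawsE H.weight k (adjacentPairs j H) := by
    intro k c
    rw [apply_add_fun _
        (fun s : Multiset (Fin H.n) => defectCount d j H + d * (c - s.toFinset.card)),
      apply_add_fun _ (fun _ => _), apply_const_mul, drawsE_const hH.sum_weight]
  have h1 := drawsE_mono H.weight_nonneg
    fun s hs => defectCount_addVertexEdge_le (j := j) (H := H) hd hs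
  have h2 := drawsE_mono H.weight_nonneg
    fun s hs => defectCount_addEdge_le (d := d) (j := j) (H := H) hs
  rw [e] at h1 h2
  have h3 := h1.trans (add_le_add_right
    (drawsE_adjacentPairs_le (j := j) hH hε (Nat.sub_le d 1)) _)
  have h4 := h2.trans (add_le_add_right (drawsE_adjacentPairs_le (j := j) hH hε le_rfl) _)
  have h5 := mul_le_mul_of_nonneg_left h3 hp0
  have h6 := mul_le_mul_of_nonneg_left h4 (sub_nonneg.2 hp1)
  have h7 := mul_le_mul_of_nonneg_left (repetition_le hp0 hp1 hH) (d.cast_nonneg (α := ℝ))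
  rw [repetition] at h7
  rw [stepE_apply]
  linarith

-- A vertex that is not defective has j neighbours exactly when (d-1)deg(v) = j; the general bound
-- by (d-1)deg(v) makes the cutoff apply in both directions.
open Classical in
theorem abs_numObservedDegree_sub_le (hH : IsAt d t H) (j : ℕ) :
    |(H.numObservedDegree j : ℝ) - ∑ v : Fin H.n, if (d - 1) * H.degree v = j then 1 else 0| ≤
      defectCount d j H := by
  rw [numObservedDegree_eq, ← Finset.sum_sub_distrib]
  refine (Finset.abs_sum_le_sum_abs _ _).trans (Finset.sum_le_sum fun v _ => ?_)
  have h1 : (coMembers H.edges v).card ≤ (d - 1) * H.degree v :=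
    card_coMembers_le H.edges v hH.card_eq
  by_cases hD : Defective d j H.edges v
  · rw [if_pos hD]
    split_ifs <;> simp
  · have h2 : (coMembers H.edges v).card = j ↔ (d - 1) * H.degree v = j := by
      rw [Defective, not_and, not_lt] at hD
      change _ → (d - 1) * H.degree v ≤ _ at hD
      constructor
      · intro h
        have := hD h.le
        omega
      · intro h
        have := hD (by omega)
        omega
    simp only [h2, sub_self, abs_zero]
    split_ifs; simp

theorem sum_mul_degree_eq {s : ℕ} (hs : 0 < s) (j : ℕ) (H : MultiHypergraph) :
    (∑ v : Fin H.n, if s * H.degree v = j then (1 : ℝ) else 0) =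
      spread s (fun k => degCount k H) j := by
  rw [spread]
  split_ifs with h
  · obtain ⟨k, rfl⟩ := h
    rw [Nat.mul_div_cancel_left k hs, degCount_eq]
    simp only [Nat.mul_right_inj hs.ne']
  · exact Finset.sum_eq_zero fun v _ => if_neg fun h' => h ⟨_, h'.symm⟩

end Defect

/-! ### Limits of the observed degree counts -/

section Limits

variable {d : ℕ} (hd : 2 ≤ d) {p : ℝ} (hp0 : 0 < p) (hp1 : p ≤ 1)
include hd hp0 hp1

theorem tendsto_lawE_defectCount (j : ℕ) :
    Tendsto (fun t : ℕ => lawE d hd p t (defectCount d j) / ((t : ℝ) + 1)) atTop (𝓝 0) := by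
  set y : ℕ → ℝ := fun t => lawE d hd p t collision with hy
  have hy0 : ∀ t, 0 ≤ y t := fun t => lawE_nonneg hd hp0.le hp1 fun H _ => H.collision_nonneg
  have hylim : Tendsto y atTop (𝓝 0) := tendsto_lawE_collision hd hp0 hp1
  -- The choice √y balances ε and y/ε; the added 1/(t+1) keeps ε positive even if y vanishes.
  set ε : ℕ → ℝ := fun t => √(y t) + 1 / ((t : ℝ) + 1) with hε
  have hεpos : ∀ t, 0 < ε t := fun t => by positivity
  have hsq : Tendsto (fun t => √(y t)) atTop (𝓝 0) := by
    simpa using hylim.sqrt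
  have hεlim : Tendsto ε atTop (𝓝 0) := by
    simpa [hε] using hsq.add tendsto_one_div_add_atTop_nhds_zero_nat
  have hdiv : Tendsto (fun t => y t / ε t) atTop (𝓝 0) := by
    refine squeeze_zero (fun t => div_nonneg (hy0 t) (hεpos t).le) (fun t => ?_) hsq
    rw [div_le_iff₀ (hεpos t)]
    calc y t = √(y t) * √(y t) := (Real.mul_self_sqrt (hy0 t)).symm
      _ ≤ √(y t) * ε t := by
        gcongr
        simp only [hε]
        linarith [show (0 : ℝ) ≤ 1 / ((t : ℝ) + 1) by positivity]
  refine tendsto_div_zero_of_increment_le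
    (c := fun t => d * (d ^ 2 * y t) + d ^ 2 * (j * (ε t + y t / ε t)))
    (fun t => lawE_nonneg hd hp0.le hp1 fun H _ => defectCount_nonneg d j H) (fun t => ?_) ?_
  · rw [lawE_succ]
    refine (lawE_mono hd hp0.le hp1 fun H hH =>
      stepE_defectCount_le hd hp0.le hp1 hH (hεpos t)).trans_eq ?_
    simp_rw [div_eq_inv_mul _ (ε t)]
    rw [apply_add_fun _ (fun H => defectCount d j H + d * (d ^ 2 * H.collision)), apply_add_fun,
      apply_const_mul, apply_const_mul, apply_const_mul, apply_const_mul,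
      apply_add_fun _ (fun _ => _), apply_const_mul, lawE_const hd hp0.le hp1, add_assoc]
  · simpa using ((hylim.const_mul ((d : ℝ) ^ 2)).const_mul (d : ℝ)).add
      (((hεlim.add hdiv).const_mul (j : ℝ)).const_mul ((d : ℝ) ^ 2))

theorem tendsto_lawE_spread_degCount {s : ℕ} (j : ℕ) :
    Tendsto (fun t : ℕ => lawE d hd p t (fun H => spread s (fun k => degCount k H) j) /
      ((t : ℝ) + 1)) atTop (𝓝 (spread s (freq ((d - p) / d) p) j)) := by
  by_cases h : s ∣ j
  · simp only [spread, if_pos h]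
    exact tendsto_lawE_degCount hd hp0 hp1 (j / s)
  · simp only [spread, if_neg h, lawE_const hd hp0.le hp1, zero_div]
    exact tendsto_const_nhds

theorem tendsto_lawE_numObservedDegree (j : ℕ) :
    Tendsto (fun t : ℕ => lawE d hd p t (fun H => (H.numObservedDegree j : ℝ)) / ((t : ℝ) + 1))
      atTop (𝓝 (spread (d - 1) (freq ((d - p) / d) p) j)) := by
  have h1 : Tendsto (fun t : ℕ => lawE d hd p t (fun H => (H.numObservedDegree j : ℝ) -
      spread (d - 1) (fun k => degCount k H) j) / ((t : ℝ) + 1)) atTop (𝓝 0) := by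
    rw [tendsto_zero_iff_abs_tendsto_zero]
    refine squeeze_zero (fun _ => abs_nonneg _) (fun t => ?_)
      (tendsto_lawE_defectCount hd hp0 hp1 j)
    have ht : (0 : ℝ) < (t : ℝ) + 1 := by positivity
    simp only [Function.comp_apply]
    rw [abs_div, abs_of_pos ht]
    refine div_le_div_of_nonneg_right (abs_lawE_le hd hp0.le hp1 fun H hH => ?_) ht.le
    rw [← sum_mul_degree_eq (by omega)]
    exact abs_numObservedDegree_sub_le hH j
  have h2 := h1.add (tendsto_lawE_spread_degCount hd hp0 hp1 (s := d - 1) j)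
  rw [zero_add] at h2
  refine h2.congr fun t => ?_
  rw [apply_sub_fun]
  ring

end Limits

end PrefAttach

/-! ### The theorem -/

theorem mainTheorem3 (d : ℕ) (hd : 2 ≤ d) (p : ℝ≥0) (hp0 : 0 < p) (hp1 : p ≤ 1) :
    (∃ M : ℕ → ℝ,
      (∀ k, Tendsto (fun t : ℕ => PrefAttach.expectedNumObserved d hd p hp1 k t / (t : ℝ))
        atTop (𝓝 (M k))) ∧
      HasSum M (p : ℝ) ∧
      PrefAttach.IsPowerLaw (d - 1) M (2 + (p : ℝ) / ((d : ℝ) - (p : ℝ)))) ∧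
    (∃ M : ℕ → ℝ,
      (∀ k, Tendsto (fun t : ℕ => PrefAttach.expectedNum 2 le_rfl p hp1 k t / (t : ℝ))
        atTop (𝓝 (M k))) ∧
      HasSum M (p : ℝ) ∧
      PrefAttach.IsPowerLaw 1 M (2 + (p : ℝ) / (2 - (p : ℝ)))) ∧
    (2 < d → 2 + (p : ℝ) / ((d : ℝ) - (p : ℝ)) ≠ 2 + (p : ℝ) / (2 - (p : ℝ))) := by
  have q0 : (0 : ℝ) < p := by exact_mod_cast hp0
  have q1 : (p : ℝ) ≤ 1 := by exact_mod_cast hp1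
  have hα : ∀ c : ℝ, 2 ≤ c → 0 < (c - p) / c := fun c hc => div_pos (by linarith) (by linarith)
  have hβ : ∀ c : ℝ, 2 ≤ c → 1 + 1 / ((c - p) / c) = 2 + p / (c - p) := fun c hc => by
    have h1 : c - p ≠ 0 := by linarith
    have h2 : c ≠ 0 := by linarith
    field_simp
    ring
  have hd2 : (2 : ℝ) ≤ d := by exact_mod_cast hd
  refine ⟨⟨PrefAttach.spread (d - 1) (PrefAttach.freq ((d - p) / d) p), fun k => ?_, ?_, ?_⟩,
    ⟨PrefAttach.spread 1 (PrefAttach.freq ((2 - p) / 2) p), fun k => ?_, ?_, ?_⟩, fun h => ?_⟩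
  · refine PrefAttach.tendsto_div_natCast ?_
    simp only [PrefAttach.expectedNumObserved, PrefAttach.integral_law]
    exact PrefAttach.tendsto_lawE_numObservedDegree hd q0 q1 k
  · exact PrefAttach.hasSum_spread (by omega) (PrefAttach.hasSum_freq (hα d hd2) q0)
  · rw [← hβ d hd2]
    exact PrefAttach.isPowerLaw_spread_freq (hα d hd2) q0 (by omega)
  · refine PrefAttach.tendsto_div_natCast ?_
    simp only [PrefAttach.expectedNum, PrefAttach.integral_law, PrefAttach.numDegree_eq]
    simpa [PrefAttach.spread] using PrefAttach.tendsto_lawE_degCount le_rfl q0 q1 k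
  · exact PrefAttach.hasSum_spread one_pos (PrefAttach.hasSum_freq (hα 2 le_rfl) q0)
  · rw [← hβ 2 le_rfl]
    exact PrefAttach.isPowerLaw_spread_freq (hα 2 le_rfl) q0 one_pos
  · have h2 : (2 : ℝ) < d := by exact_mod_cast h
    have h3 : (p : ℝ) / (d - p) < p / (2 - p) :=
      div_lt_div_of_pos_left q0 (by linarith) (by linarith)
    exact fun e => h3.ne (add_left_cancel e)
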